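/- Conventions. Let $P$ be a smooth finite-dimensional (Hausdorff) manifold with a Poisson structure $\{\cdot,\cdot\}$, i.e. a Lie bracket on $C^\infty(P)$ that is a derivation in each entry. For $H\in C^\infty(P)$ the Hamiltonian vector field $X_H$ is given by $\mathbf dF(X_H)=\{F,H\}$ for all $F\in C^\infty(P)$. For an ideal $\mathcal I\subset C^\infty(P)$ put $\mathcal V_{\mathcal I}=\{z\in P\mid f(z)=0\ \forall f\in\mathcal I\}$; $\mathcal I$ is a Poisson ideal if $\{f,g\}\in\mathcal I$ for all $f\in C^\infty(P)$, $g\in\mathcal I$, and it is regular if $\mathcal V_{\mathcal I}$ is a closed embedded submanifold of $P$. For a regular finitely generated Poisson ideal, $\mathcal V_{\mathcal I}$ carries the reduced Poisson bracket $\{f,g\}_{\mathcal V_{\mathcal I}}(s)=\{F,G\}(s)$, where $F,G\in C^\infty(P)$ are arbitrary local extensions of $f,g\in C^\infty(\mathcal V_{\mathcal I})$ around $s$. A sub-Casimir is a function $F\in C^\infty(P)$ whose restriction to $\mathcal V_{\mathcal I}$ is a Casimir of $\{\cdot,\cdot\}_{\mathcal V_{\mathcal I}}$, i.e. has zero reduced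 bracket with every smooth function on $\mathcal V_{\mathcal I}$. An equilibrium $m$ of a vector field with flow $F_t$ is Lyapunov stable if every open neighborhood $U$ of $m$ contains an open neighborhood $V$ of $m$ such that, for all $x\in V$ and $t>0$, $F_t(x)$ is defined and lies in $U$. A point $z_e\in\mathcal V_{\mathcal I}$ with $X_H(z_e)=0$ is an $\mathcal I$-stable equilibrium if the following two equivalent conditions hold: (a) $z_e$ is a Lyapunov stable equilibrium of the reduced system $(\mathcal V_{\mathcal I},\{\cdot,\cdot\}_{\mathcal V_{\mathcal I}},H|_{\mathcal V_{\mathcal I}})$; (b) for every open neighborhood $U$ of $z_e$ in $P$ there is an open neighborhood $V$ of $z_e$ in $P$ such that, $F_t$ being the flow of $X_H$, $F_t(z)$ is defined and lies in $U\cap\mathcal V_{\mathcal I}$ for all $z\in V\cap\mathcal V_{\mathcal I}$ and $t>0$. Theorem. Let $(P,\{\cdot,\cdot\})$ be a Poisson manifold as above, $H\in C^\infty(P)$, and $z_e\in P$ with $X_H(z_e)=0$. Let $\mathcal I$ be a regular Poisson ideal generated by $G_1,\dots,G_m\in C^\infty(P)$ with $z_e\in\mathcal V_{\mathcal I}$,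 and let $F_1,\dots,F_r\in C^\infty(P)$ be sub-Casimirs. Let $C_0:=H,C_1,\dots,C_n\in C^\infty(P)$ be conserved by the flow of $X_H$. Suppose that there are real constants $\lambda_0,\dots,\lambda_n$, $\mu_1,\dots,\mu_r$, $\nu_1,\dots,\nu_m$ such that (i) $H_1:=\sum_{i=0}^n\lambda_iC_i+\sum_{j=1}^r\mu_jF_j+\sum_{k=1}^m\nu_kG_k$ has a critical point at $z_e$, and (ii) the Hessian of $H_1$ at $z_e$ is positive definite on $$W=\bigcap_{i=0}^n\ker\mathbf dC_i(z_e)\ \cap\ \bigcap_{j=1}^r\ker\mathbf dF_j(z_e)\ \cap\ \bigcap_{k=1}^m\ker\mathbf dG_k(z_e)\subset T_{z_e}P.$$ Then $z_e$ is an $\mathcal I$-stable equilibrium. -/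

import Mathlib

open scoped Manifold ContDiff Topology

noncomputable section

/-- `C^∞(M)`, the algebra of smooth real functions on a manifold modelled on `E`. -/
abbrev SmoothFun (E : Type*) [NormedAddCommGroup E] [NormedSpace ℝ E]
    (M : Type*) [TopologicalSpace M] [ChartedSpace E M] : Type _ :=
  C^∞⟮𝓘(ℝ, E), M; ℝ⟯

/-- A Poisson structure on `M`: a Lie bracket on `C^∞(M)` that is a derivation in each entry
(the derivation property in the second entry follows from antisymmetry). -/
structure PoissonStructure (E : Type*) [NormedAddCommGroup E] [NormedSpace ℝ E]
    (M : Type*) [TopologicalSpace M] [ChartedSpace E M] where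
  bracket : SmoothFun E M →ₗ[ℝ] SmoothFun E M →ₗ[ℝ] SmoothFun E M
  bracket_self : ∀ F, bracket F F = 0
  jacobi : ∀ F G K, bracket F (bracket G K) + bracket G (bracket K F)
    + bracket K (bracket F G) = 0
  leibniz : ∀ F G K, bracket (F * G) K = F * bracket G K + G * bracket F K

section OneManifold

variable {E : Type*} [NormedAddCommGroup E] [NormedSpace ℝ E]
  {M : Type*} [TopologicalSpace M] [ChartedSpace E M]

/-- The differential `dF(z)` as a linear functional on `T_z M`. -/
def differential (F : SmoothFun E M) (z : M) : TangentSpace 𝓘(ℝ, E) z →L[ℝ] ℝ :=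
  mfderiv 𝓘(ℝ, E) 𝓘(ℝ, ℝ) F z

/-- The Hessian `d²F(z)(v, w) = v[W[F]]` of `F` at a critical point `z`.  As the vector field `W`
extending `w` we take the field that is constant in the preferred chart at `z`; this is the chart
through which `TangentSpace 𝓘(ℝ, E) z` is identified with `E`.  At a critical point the value does
not depend on this choice. -/
def hessian (F : SmoothFun E M) (z : M) (v w : TangentSpace 𝓘(ℝ, E) z) : ℝ :=
  fderiv ℝ
    (fun x : E => fderiv ℝ (fun y : E => F ((extChartAt 𝓘(ℝ, E) z).symm y)) x (w : E))
    (extChartAt 𝓘(ℝ, E) z z) (v : E)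

/-- The Hamiltonian vector field of `H` for a bracket `br` on `C^∞(M)`: its value at `z` is the
tangent vector `v` with `dF(z) v = {F, H}(z)` for every `F ∈ C^∞(M)`. -/
def hamiltonianVectorField (br : SmoothFun E M → SmoothFun E M → M → ℝ) (H : SmoothFun E M)
    (z : M) : TangentSpace 𝓘(ℝ, E) z :=
  @Classical.epsilon (TangentSpace 𝓘(ℝ, E) z) ⟨0⟩
    fun v => ∀ F : SmoothFun E M, differential F z v = br F H z

/-- The bracket of a Poisson structure, as a function of points. -/
def PoissonStructure.br (π : PoissonStructure E M) (F G : SmoothFun E M) (z : M) : ℝ :=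
  π.bracket F G z

/-- `X_H` on the Poisson manifold `(M, π)`. -/
def PoissonStructure.hamVF (π : PoissonStructure E M) (H : SmoothFun E M) (z : M) :
    TangentSpace 𝓘(ℝ, E) z :=
  hamiltonianVectorField π.br H z

/-- A function is a Casimir for the bracket `br` if it commutes with all smooth functions. -/
def IsCasimir (br : SmoothFun E M → SmoothFun E M → M → ℝ) (c : SmoothFun E M) : Prop :=
  ∀ (g : SmoothFun E M) (z : M), br c g z = 0

/-- `C` is conserved by the flow of `X`: it is constant along every integral curve of `X`
defined on an interval `s`. -/
def IsConservedBy (X : ∀ z : M, TangentSpace 𝓘(ℝ, E) z) (C : SmoothFun E M) : Prop :=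
  ∀ (γ : ℝ → M) (s : Set ℝ), s.OrdConnected → IsMIntegralCurveOn γ X s →
    ∀ t₁ ∈ s, ∀ t₂ ∈ s, C (γ t₁) = C (γ t₂)

/-- The forward orbit of `z` under the flow `F_t` of `X` is defined for all times `t ≥ 0`, and
`F_t(z) ∈ A` for all `t > 0`. -/
def ForwardOrbitIn (X : ∀ z : M, TangentSpace 𝓘(ℝ, E) z) (z : M) (A : Set M) : Prop :=
  (∃ γ : ℝ → M, γ 0 = z ∧ IsMIntegralCurveOn γ X (Set.Ici 0)) ∧
  ∀ γ : ℝ → M, γ 0 = z → IsMIntegralCurveOn γ X (Set.Ici 0) → ∀ t > 0, γ t ∈ A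

/-- `z` is a (Lyapunov) stable equilibrium of the vector field `X`. -/
def IsStableEquilibrium (X : ∀ z : M, TangentSpace 𝓘(ℝ, E) z) (z : M) : Prop :=
  X z = 0 ∧
  ∀ U : Set M, IsOpen U → z ∈ U →
    ∃ V : Set M, IsOpen V ∧ z ∈ V ∧ V ⊆ U ∧ ∀ x ∈ V, ForwardOrbitIn X x U

/-- The vanishing set `V_I ⊆ M` of an ideal of `C^∞(M)`. -/
def vanishingSet (I : Ideal (SmoothFun E M)) : Set M := {z | ∀ f ∈ I, f z = 0}

/-- `I` is a Poisson ideal: an ideal for the product which is also one for the Lie bracket. -/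
def IsPoissonIdeal (π : PoissonStructure E M) (I : Ideal (SmoothFun E M)) : Prop :=
  ∀ f : SmoothFun E M, ∀ g ∈ I, π.bracket f g ∈ I

end OneManifold

section Submanifold

variable {E : Type*} [NormedAddCommGroup E] [NormedSpace ℝ E]
  {P : Type*} [TopologicalSpace P] [ChartedSpace E P]
  {E' : Type*} [NormedAddCommGroup E'] [NormedSpace ℝ E']
  {S : Type*} [TopologicalSpace S] [ChartedSpace E' S]

/-- `ι : S → P` presents the vanishing set of the ideal `I` as a closed embedded submanifold `S`
of `P` with inclusion `ι`; an ideal with such a presentation is called regular. -/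
structure IsRegularVia (I : Ideal (SmoothFun E P))
    (ι : C^∞⟮𝓘(ℝ, E'), S; 𝓘(ℝ, E), P⟯) : Prop where
  isSmoothEmbedding : Manifold.IsSmoothEmbedding 𝓘(ℝ, E') 𝓘(ℝ, E) ∞ ι
  range_eq : Set.range ι = vanishingSet I
  isClosed : IsClosed (vanishingSet I)

/-- `F ∈ C^∞(P)` is a local extension of `f ∈ C^∞(S)` around the point `s ∈ S`. -/
def IsLocalExtension (ι : C^∞⟮𝓘(ℝ, E'), S; 𝓘(ℝ, E), P⟯) (f : SmoothFun E' S) (s : S)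
    (F : SmoothFun E P) : Prop :=
  ∃ U : Set P, IsOpen U ∧ ι s ∈ U ∧ ∀ s' : S, ι s' ∈ U → f s' = F (ι s')

/-- The reduced bracket on `C^∞(S)`: `{f, g}_S(s)` is the common value of `{F, G}(s)` for
arbitrary local extensions `F`, `G` of `f`, `g` around `s`. -/
def reducedBracket (π : PoissonStructure E P) (ι : C^∞⟮𝓘(ℝ, E'), S; 𝓘(ℝ, E), P⟯)
    (f g : SmoothFun E' S) (s : S) : ℝ :=
  Classical.epsilon fun c : ℝ => ∀ F G : SmoothFun E P,
    IsLocalExtension ι f s F → IsLocalExtension ι g s G → π.br F G (ι s) = c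

/-- `F ∈ C^∞(P)` is a sub-Casimir: it extends a Casimir of `(S, {·,·}_S)`. -/
def IsSubCasimir (π : PoissonStructure E P) (ι : C^∞⟮𝓘(ℝ, E'), S; 𝓘(ℝ, E), P⟯)
    (F : SmoothFun E P) : Prop :=
  ∃ c : SmoothFun E' S, IsCasimir (reducedBracket π ι) c ∧ ∀ s : S, F (ι s) = c s

/-- `z_e` is an `I`-stable equilibrium of `(P, {·,·}, H)`, where `ι : S → P` is the inclusion of
the vanishing submanifold of `I`.  Both of the usual descriptions are required: `reduced` (stable
for the reduced system on `S` with Hamiltonian `h = H ∘ ι`) and `ambient` (stable for the flow of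
`X_H` on `P` with respect to initial conditions in the vanishing set). -/
structure IsIdealStable (π : PoissonStructure E P) (H : SmoothFun E P)
    (I : Ideal (SmoothFun E P)) (ι : C^∞⟮𝓘(ℝ, E'), S; 𝓘(ℝ, E), P⟯) (z_e : P) : Prop where
  mem : z_e ∈ vanishingSet I
  equilibrium : π.hamVF H z_e = 0
  reduced : ∀ s_e : S, ι s_e = z_e →
    IsStableEquilibrium (hamiltonianVectorField (reducedBracket π ι) (H.comp ι)) s_e
  ambient : ∀ U : Set P, IsOpen U → z_e ∈ U →
    ∃ V : Set P, IsOpen V ∧ z_e ∈ V ∧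
      ∀ z ∈ V ∩ vanishingSet I, ForwardOrbitIn (π.hamVF H) z (U ∩ vanishingSet I)

end Submanifold

end

/-! ### Calculus on the model space: Hadamard, Taylor, Finsler, complete vector fields -/

section Calculus

open Set Filter MeasureTheory Asymptotics

variable {E : Type*} [NormedAddCommGroup E] [NormedSpace ℝ E]

/-! Let `Q a` run through all the `C i`, `F j` and `G k`, and put Φ = H₁ - H₁(z_e) + K ∑ (Q a - Q
a(z_e))². The Hessian of Φ at the critical point z_e is that of H₁ plus 2K ∑ (dQ a)². It is positive
definite for large K by Finsler's lemma, so Φ has a strict local minimum at z_e in all of P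
(`exists_strict_local_min_of_hessian_pos`).

Along integral curves of X_H in the vanishing set, Φ is constant because every `Q a` is. The `C i`
are conserved by hypothesis, and a sub-Casimir has zero bracket with H at points of the vanishing
set. The `G k` vanish there, and the set is invariant: {G_k, H} = ∑ a_kl G_l is a linear ODE for the
G_k along a curve, and Grönwall keeps the zero solution zero
(`IsPoissonIdeal.mem_vanishingSet_of_isMIntegralCurveOn`). Lyapunov's argument then gives
description (b): a curve starting where Φ is below its minimum on the frontier of a compact
neighbourhood cannot leave that neighbourhood, hence exists for all positive time
(`PoissonStructure.exists_nhds_forwardOrbitIn`).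

For description (a), invariance also shows that {F, H}(s) depends only on F along the vanishing set.
So the reduced bracket is well defined and its Hamiltonian vector field is ι-related to X_H
(`mfderiv_reduced_hamiltonianVectorField`). Integral curves then pass between S and P, and (b)
yields (a).

Brackets are abstract derivations, so even the existence of X_H needs proof: Hadamard's lemma turns
derivations at a point into tangent vectors. -/

lemma hasFDerivAt_intervalIntegral_mul_comp_smul [FiniteDimensional ℝ E] {φ : ℝ → ℝ}
    (hφ : Continuous φ) {g : E → ℝ} (hg : ContDiff ℝ 1 g) (x : E) :
    HasFDerivAt (fun x => ∫ t in (0 : ℝ)..1, φ t * g (t • x))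
      (∫ t in (0 : ℝ)..1, (φ t * t) • fderiv ℝ g (t • x)) x := by
  have hg' : Continuous (fderiv ℝ g) := hg.continuous_fderiv one_ne_zero
  have hcont : Continuous fun p : E × ℝ => (φ p.2 * p.2) • fderiv ℝ g (p.2 • p.1) := by fun_prop
  obtain ⟨C, hC⟩ := ((isCompact_closedBall x 1).prod
    (isCompact_Icc (a := (0 : ℝ)) (b := 1))).exists_bound_of_continuousOn hcont.continuousOn
  refine intervalIntegral.hasFDerivAt_integral_of_dominated_of_fderiv_le
    (bound := fun _ => C) (F' := fun x t => (φ t * t) • fderiv ℝ g (t • x))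
    (Metric.ball_mem_nhds x one_pos) ?_ ?_ ?_ ?_ ?_ ?_
  · refine .of_forall fun y => Continuous.aestronglyMeasurable ?_
    have := hg.continuous
    fun_prop
  · have := hg.continuous
    exact Continuous.intervalIntegrable (by fun_prop) _ _
  · exact Continuous.aestronglyMeasurable (by fun_prop)
  · refine .of_forall fun t ht y hy => hC (y, t) ⟨Metric.ball_subset_closedBall hy, ?_⟩
    rw [uIoc_of_le zero_le_one] at ht
    exact Ioc_subset_Icc_self ht
  · exact intervalIntegrable_const
  · refine .of_forall fun t _ y _ => ?_
    have h1 : HasFDerivAt (fun y : E => t • y) (t • ContinuousLinearMap.id ℝ E) y :=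
      (hasFDerivAt_id y).const_smul t
    have h2 := ((hg.differentiable one_ne_zero (t • y)).hasFDerivAt.comp y h1).const_mul (φ t)
    refine h2.congr_fderiv ?_
    ext v
    simp [mul_assoc]

/-- Each directional derivative produces an integral of the same shape, with weight `φ t * t` and
`g` replaced by its directional derivative. Allowing an arbitrary continuous weight is what lets the
induction close. -/
lemma contDiff_intervalIntegral_mul_comp_smul [FiniteDimensional ℝ E] (n : ℕ) {φ : ℝ → ℝ}
    (hφ : Continuous φ) {g : E → ℝ} (hg : ContDiff ℝ ∞ g) :
    ContDiff ℝ n fun x => ∫ t in (0 : ℝ)..1, φ t * g (t • x) := by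
  have hdiff : ∀ {φ : ℝ → ℝ} (_ : Continuous φ) {g : E → ℝ} (_ : ContDiff ℝ ∞ g),
      Differentiable ℝ fun x => ∫ t in (0 : ℝ)..1, φ t * g (t • x) := fun hφ _ hg x =>
    (hasFDerivAt_intervalIntegral_mul_comp_smul hφ (hg.of_le (by norm_cast))
      x).differentiableAt
  induction n generalizing φ g with
  | zero => exact contDiff_zero.2 (hdiff hφ hg).continuous
  | succ n ih =>
    push_cast
    refine contDiff_succ_iff_fderiv_apply.2 ⟨hdiff hφ hg, by simp, fun y => ?_⟩
    have hg1 : ContDiff ℝ 1 g := hg.of_le (by norm_cast)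
    have hg' : Continuous (fderiv ℝ g) := hg1.continuous_fderiv one_ne_zero
    have key : (fun x => fderiv ℝ (fun x => ∫ t in (0 : ℝ)..1, φ t * g (t • x)) x y) =
        fun x => ∫ t in (0 : ℝ)..1, (φ t * t) * (fun z => fderiv ℝ g z y) (t • x) := by
      ext x
      rw [(hasFDerivAt_intervalIntegral_mul_comp_smul hφ hg1 x).fderiv,
        ContinuousLinearMap.intervalIntegral_apply]
      · simp
      · exact Continuous.intervalIntegrable (by fun_prop) _ _
    rw [key]
    exact ih (by fun_prop) ((hg.fderiv_right (m := ∞) (by simp)).clm_apply contDiff_const)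

/-- **Hadamard's lemma**. -/
lemma ContDiff.exists_eq_add_sum_coord_mul {κ : Type*} [Fintype κ] (b : Module.Basis κ ℝ E)
    {f : E → ℝ} (hf : ContDiff ℝ ∞ f) (x₀ : E) :
    ∃ g : κ → E → ℝ, (∀ i, ContDiff ℝ ∞ (g i)) ∧ (∀ i, g i x₀ = fderiv ℝ f x₀ (b i)) ∧
      ∀ x, f x = f x₀ + ∑ i, b.coord i (x - x₀) * g i x := by
  have : FiniteDimensional ℝ E := b.finiteDimensional_of_finite
  have hf1 : ContDiff ℝ 1 f := hf.of_le (by norm_cast)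
  have hf' : Continuous (fderiv ℝ f) := hf1.continuous_fderiv one_ne_zero
  have hd : Differentiable ℝ f := hf1.differentiable one_ne_zero
  -- The coefficients are the partial derivatives averaged over the segment from `x₀` to `x`; the
  -- factor `1` is the initial weight `φ`.
  refine ⟨fun i x => ∫ t in (0 : ℝ)..1, 1 * fderiv ℝ f (x₀ + t • (x - x₀)) (b i),
    fun i => ?_, fun i => by simp, fun x => ?_⟩
  · have h : ContDiff ℝ ∞ fun y => ∫ t in (0 : ℝ)..1,
        (fun _ : ℝ => (1 : ℝ)) t * (fun y => fderiv ℝ f (x₀ + y) (b i)) (t • y) := by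
      refine contDiff_infty.2 fun n =>
        contDiff_intervalIntegral_mul_comp_smul (φ := fun _ => 1)
          (g := fun y => fderiv ℝ f (x₀ + y) (b i)) n continuous_const ?_
      exact ((hf.fderiv_right (m := ∞) (by simp)).comp
        (contDiff_const.add contDiff_id)).clm_apply contDiff_const
    exact h.comp (contDiff_id.sub contDiff_const)
  · have h1 : ∀ t : ℝ, HasDerivAt (fun t : ℝ => f (x₀ + t • (x - x₀)))
        (fderiv ℝ f (x₀ + t • (x - x₀)) (x - x₀)) t := fun t => by
      have h2 : HasDerivAt (fun t : ℝ => x₀ + t • (x - x₀)) (x - x₀) t := by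
        simpa using ((hasDerivAt_id t).smul_const (x - x₀)).const_add x₀
      exact (hd _).hasFDerivAt.comp_hasDerivAt t h2
    have h3 := intervalIntegral.integral_eq_sub_of_hasDerivAt (a := 0) (b := 1)
      (fun t _ => h1 t) (Continuous.intervalIntegrable (by fun_prop) _ _)
    simp only [one_smul, add_sub_cancel, zero_smul, add_zero] at h3
    rw [← sub_eq_iff_eq_add', ← h3]
    simp_rw [one_mul, ← intervalIntegral.integral_const_mul]
    rw [← intervalIntegral.integral_finsetSum]
    · refine intervalIntegral.integral_congr fun t _ => ?_
      conv_lhs => enter [2]; rw [← b.sum_repr (x - x₀)]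
      simp only [map_sum, map_smul, smul_eq_mul, b.coord_apply]
    · exact fun i _ => Continuous.intervalIntegrable (by fun_prop) _ _

/-- Second order Taylor expansion at a critical point. -/
lemma ContDiffAt.isLittleO_sub_half_snd_fderiv {f : E → ℝ} {x₀ : E} (hf : ContDiffAt ℝ 2 f x₀)
    (hcrit : fderiv ℝ f x₀ = 0) :
    (fun x => f x - f x₀ - 1 / 2 * fderiv ℝ (fderiv ℝ f) x₀ (x - x₀) (x - x₀))
      =o[𝓝 x₀] fun x => ‖x - x₀‖ ^ 2 := by
  set A := fderiv ℝ (fderiv ℝ f) x₀ with hA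
  have hsymm : ∀ u v, A u v = A v u := hf.isSymmSndFDerivAt (by simp)
  have hdA : HasFDerivAt (fderiv ℝ f) A x₀ :=
    ((hf.fderiv_right (m := 1) (by norm_num)).differentiableAt one_ne_zero).hasFDerivAt
  have hev : ∀ᶠ x in 𝓝 x₀, DifferentiableAt ℝ f x := by
    filter_upwards [hf.eventually (by simp)] with x hx using hx.differentiableAt two_ne_zero
  rw [isLittleO_iff]
  intro ε hε
  have h1 := (hasFDerivAt_iff_isLittleO.1 hdA).def hε
  obtain ⟨δ, hδ, hball⟩ := Metric.eventually_nhds_iff_ball.1 (h1.and hev)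
  filter_upwards [Metric.ball_mem_nhds x₀ hδ] with x hx
  -- Mean value inequality for `f` minus its quadratic part: by symmetry of `A` the derivative is
  -- `fderiv ℝ f y - A (y - x₀)`, of norm at most `ε * ‖x - x₀‖` on the segment.
  have hr : ∀ y ∈ segment ℝ x₀ x, HasFDerivWithinAt
      (fun y => f y - 1 / 2 * A (y - x₀) (y - x₀)) (fderiv ℝ f y - A (y - x₀))
      (segment ℝ x₀ x) y := by
    intro y hy
    have hyb : y ∈ Metric.ball x₀ δ :=
      (convex_ball x₀ δ).segment_subset (Metric.mem_ball_self hδ) hx hy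
    have h2 : HasFDerivAt (fun y => y - x₀) (ContinuousLinearMap.id ℝ E) y :=
      (hasFDerivAt_id y).sub_const x₀
    have h3 := (((A.hasFDerivAt (x := y - x₀)).comp y h2).clm_apply h2).const_mul (1 / 2)
    refine HasFDerivAt.hasFDerivWithinAt
      (((hball y hyb).2.hasFDerivAt.sub h3).congr_fderiv ?_)
    ext v
    simp only [sub_apply, smul_apply,
      add_apply, ContinuousLinearMap.comp_apply,
      ContinuousLinearMap.flip_apply, ContinuousLinearMap.id_apply, smul_eq_mul,
      Function.comp_apply, hsymm v (y - x₀)]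
    ring
  have hbd : ∀ y ∈ segment ℝ x₀ x, ‖fderiv ℝ f y - A (y - x₀)‖ ≤ ε * ‖x - x₀‖ := by
    intro y hy
    have hyb : y ∈ Metric.ball x₀ δ :=
      (convex_ball x₀ δ).segment_subset (Metric.mem_ball_self hδ) hx hy
    have h4 := (hball y hyb).1
    rw [hcrit, sub_zero] at h4
    refine h4.trans (mul_le_mul_of_nonneg_left ?_ hε.le)
    obtain ⟨t, ht, rfl⟩ := (segment_eq_image' ℝ x₀ x).subset hy
    rw [add_sub_cancel_left, norm_smul, Real.norm_of_nonneg ht.1]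
    exact mul_le_of_le_one_left (norm_nonneg _) ht.2
  have h5 := (convex_segment x₀ x).norm_image_sub_le_of_norm_hasFDerivWithin_le hr hbd
    (left_mem_segment ℝ x₀ x) (right_mem_segment ℝ x₀ x)
  simp only [sub_self, map_zero, mul_zero, sub_zero] at h5
  rw [Real.norm_of_nonneg (by positivity : (0 : ℝ) ≤ ‖x - x₀‖ ^ 2), pow_two, ← mul_assoc]
  rwa [sub_right_comm]

/-- **Finsler's lemma**: a quadratic form that is positive on the common kernel of finitely many
functionals becomes positive definite after adding a multiple of the sum of their squares. -/
lemma exists_pos_mul_norm_sq_le [FiniteDimensional ℝ E] {κ : Type*} [Fintype κ]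
    (A : E →L[ℝ] E →L[ℝ] ℝ) (l : κ → E →L[ℝ] ℝ)
    (h : ∀ v, (∀ a, l a v = 0) → v ≠ 0 → 0 < A v v) :
    ∃ K : ℝ, ∃ c > 0, ∀ v, c * ‖v‖ ^ 2 ≤ A v v + K * ∑ a, l a v ^ 2 := by
  set S := Metric.sphere (0 : E) 1
  have hS : IsCompact S := isCompact_sphere 0 1
  have hcont : ∀ K : ℝ, Continuous fun v => A v v + K * ∑ a, l a v ^ 2 := fun K => by fun_prop
  -- These open sets grow with `K` and cover the compact unit sphere, so a single one covers it. Off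
  -- the common kernel the sum of squares is positive and a large `K` wins.
  obtain ⟨K, hK⟩ : ∃ K : ℕ, S ⊆ {v | 0 < A v v + K * ∑ a, l a v ^ 2} := by
    refine hS.elim_directed_cover _ (fun K => isOpen_lt continuous_const (hcont K)) ?_ ?_
    · intro v hv
      have hv0 : v ≠ 0 := ne_zero_of_mem_unit_sphere (⟨v, hv⟩ : Metric.sphere (0 : E) 1)
      rw [mem_iUnion]
      by_cases hl : ∀ a, l a v = 0
      · exact ⟨0, by simpa using h v hl hv0⟩
      · push Not at hl
        obtain ⟨a, ha⟩ := hl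
        have hp : 0 < ∑ a, l a v ^ 2 :=
          Finset.sum_pos' (fun _ _ => sq_nonneg _) ⟨a, Finset.mem_univ a, by positivity⟩
        obtain ⟨K, hK⟩ := exists_nat_gt (-A v v / ∑ a, l a v ^ 2)
        refine ⟨K, ?_⟩
        rw [div_lt_iff₀ hp] at hK
        change 0 < A v v + K * ∑ a, l a v ^ 2
        linarith
    · refine Monotone.directed_le fun K L hKL v hv => ?_
      have : (K : ℝ) * ∑ a, l a v ^ 2 ≤ L * ∑ a, l a v ^ 2 := by gcongr
      exact lt_of_lt_of_le (show 0 < A v v + K * ∑ a, l a v ^ 2 from hv)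
        (show _ ≤ A v v + L * ∑ a, l a v ^ 2 by linarith)
  obtain ⟨c, hc, hcS⟩ : ∃ c > 0, ∀ v ∈ S, c ≤ A v v + K * ∑ a, l a v ^ 2 := by
    -- The sphere is empty when `E` is trivial.
    rcases S.eq_empty_or_nonempty with hE | hne
    · exact ⟨1, one_pos, by simp [hE]⟩
    · obtain ⟨v, hv, hmin⟩ := hS.exists_isMinOn hne (hcont K).continuousOn
      exact ⟨_, hK hv, fun w hw => hmin hw⟩
  refine ⟨K, c, hc, fun v => ?_⟩
  rcases eq_or_ne v 0 with rfl | hv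
  · simp
  have hn : 0 < ‖v‖ := norm_pos_iff.2 hv
  have h1 := hcS (‖v‖⁻¹ • v) (by simp [S, norm_smul, hn.ne'])
  simp only [map_smul, smul_apply, smul_eq_mul, mul_pow,
    ← Finset.mul_sum] at h1
  have h2 : ‖v‖⁻¹ * (‖v‖⁻¹ * A v v) + K * (‖v‖⁻¹ ^ 2 * ∑ a, l a v ^ 2) =
    (A v v + K * ∑ a, l a v ^ 2) / ‖v‖ ^ 2 := by field_simp
  rwa [h2, le_div_iff₀ (by positivity)] at h1

/-- A function with a critical point whose Hessian is positive definite on the common kernel of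
the differentials of finitely many functions `q a` acquires a strict local minimum after adding a
multiple of the sum of the squares of the increments of the `q a`. -/
lemma exists_strict_local_min_add_sum_sq [FiniteDimensional ℝ E] {κ : Type*} [Fintype κ]
    {f : E → ℝ} {q : κ → E → ℝ} {x₀ : E} (hf : ContDiffAt ℝ 2 f x₀)
    (hq : ∀ a, DifferentiableAt ℝ (q a) x₀) (hcrit : fderiv ℝ f x₀ = 0)
    (hpos : ∀ v, (∀ a, fderiv ℝ (q a) x₀ v = 0) → v ≠ 0 →
      0 < fderiv ℝ (fderiv ℝ f) x₀ v v) :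
    ∃ K : ℝ, ∀ᶠ x in 𝓝 x₀, x ≠ x₀ → 0 < f x - f x₀ + K * ∑ a, (q a x - q a x₀) ^ 2 := by
  obtain ⟨K, c, hc, hKc⟩ := exists_pos_mul_norm_sq_le
    ((1 / 2 : ℝ) • fderiv ℝ (fderiv ℝ f) x₀) (fun a => fderiv ℝ (q a) x₀)
    (fun v hv hv0 => by simpa using hpos v hv hv0)
  refine ⟨K, ?_⟩
  have hO : ∀ l : E →L[ℝ] ℝ, (fun x => l (x - x₀)) =O[𝓝 x₀] fun x => x - x₀ := fun l =>
    l.isBigO_comp _ _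
  -- A difference of squares: one factor is o(x - x₀), the other O(x - x₀).
  have h1 : ∀ a, (fun x => (q a x - q a x₀) ^ 2 - fderiv ℝ (q a) x₀ (x - x₀) ^ 2)
      =o[𝓝 x₀] fun x => ‖x - x₀‖ ^ 2 := by
    intro a
    have h2 := hasFDerivAt_iff_isLittleO.1 (hq a).hasFDerivAt
    have h3 : (fun x => q a x - q a x₀ + fderiv ℝ (q a) x₀ (x - x₀)) =O[𝓝 x₀]
        fun x => x - x₀ := (hq a).hasFDerivAt.isBigO_sub.add (hO _)
    refine ((h2.norm_right.mul_isBigO h3.norm_right)).congr (fun x => by ring) fun x => ?_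
    rw [pow_two]
  have h4 := (hf.isLittleO_sub_half_snd_fderiv hcrit).add
    ((IsLittleO.fun_sum fun a (_ : a ∈ Finset.univ) => h1 a).const_mul_left K)
  -- The quadratic part is at least `c * ‖x - x₀‖ ^ 2`, the remainder at most half of that.
  filter_upwards [h4.def (half_pos hc)] with x hx hne
  have hn : 0 < ‖x - x₀‖ := norm_pos_iff.2 (sub_ne_zero.2 hne)
  have h5 := hKc (x - x₀)
  rw [Real.norm_of_nonneg (by positivity : (0 : ℝ) ≤ ‖x - x₀‖ ^ 2), Real.norm_eq_abs] at hx
  have h6 := (abs_le.1 hx).1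
  rw [Finset.sum_sub_distrib] at h6
  simp only [smul_apply, smul_eq_mul] at h5
  have h7 : 0 < c * ‖x - x₀‖ ^ 2 := by positivity
  linarith

/-- A compactly supported `C¹` vector field on a finite-dimensional space is complete. -/
lemma ContDiff.exists_forall_hasDerivAt_of_hasCompactSupport [FiniteDimensional ℝ E] {w : E → E}
    (hw : ContDiff ℝ 1 w) (hc : HasCompactSupport w) (x : E) :
    ∃ η : ℝ → E, η 0 = x ∧ ∀ t, HasDerivAt η (w (η t)) t := by
  obtain ⟨K, hK⟩ := hw.lipschitzWith_of_hasCompactSupport hc one_ne_zero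
  obtain ⟨L, hL⟩ := hw.continuous.bounded_above_of_compact_support hc
  have h := exists_isMIntegralCurve_of_isMIntegralCurveOn (I := 𝓘(ℝ, E)) (M := E) (v := w)
    (fun y => contMDiffAt_vectorSpace_iff_contDiffAt.2 hw.contDiffAt) (ε := 1) one_pos
    (fun y => ?_) x
  · obtain ⟨η, h0, hη⟩ := h
    refine ⟨η, h0, fun t => ?_⟩
    have h1 : HasFDerivAt η ((1 : ℝ →L[ℝ] ℝ).smulRight (w (η t))) t :=
      hasMFDerivAt_iff_hasFDerivAt.1 (hη t)
    simpa using h1.hasDerivAt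
  -- With speed at most `L`, a solution moves at most `L` in unit time, so a ball of radius `L`
  -- works around every `y`. The existence time is thus uniform, which gives global solutions.
  · have hPL : IsPicardLindelof (fun _ => w) (tmin := -1) (tmax := 1) ⟨0, by simp⟩ y
        L.toNNReal 0 L.toNNReal K := by
      refine .of_time_independent (fun z _ => (hL z).trans (Real.le_coe_toNNReal L))
        hK.lipschitzOnWith (by simp)
    obtain ⟨η, h0, hη⟩ := hPL.exists_eq_forall_mem_Icc_hasDerivWithinAt₀
    refine ⟨η, h0, ?_⟩
    exact fun t ht =>
      ((hη t (Ioo_subset_Icc_self ht)).mono Ioo_subset_Icc_self).hasFDerivWithinAt.hasMFDerivWithinAt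

end Calculus

/-! ### Tangent vectors as point derivations; existence of Hamiltonian vector fields -/

section TangentVectors

open Set Filter

variable {E : Type*} [NormedAddCommGroup E] [NormedSpace ℝ E]
  {M : Type*} [TopologicalSpace M] [ChartedSpace E M]

lemma SmoothFun.contMDiff (F : SmoothFun E M) : ContMDiff 𝓘(ℝ, E) 𝓘(ℝ, ℝ) ∞ F :=
  ContMDiffMap.contMDiff F

lemma SmoothFun.mdifferentiableAt (F : SmoothFun E M) (z : M) :
    MDifferentiableAt 𝓘(ℝ, E) 𝓘(ℝ, ℝ) F z :=
  F.contMDiff.mdifferentiable (by simp) z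

lemma SmoothFun.hasMFDerivAt (F : SmoothFun E M) (z : M) :
    HasMFDerivAt 𝓘(ℝ, E) 𝓘(ℝ, ℝ) F z (differential F z) :=
  (F.mdifferentiableAt z).hasMFDerivAt

/-- A smooth function near a point agrees near that point with a global smooth function. -/
lemma exists_smoothFun_eventuallyEq [FiniteDimensional ℝ E] [T2Space M] [IsManifold 𝓘(ℝ, E) ∞ M]
    {U : Set M} (hU : IsOpen U) {z : M} (hz : z ∈ U) {g : M → ℝ}
    (hg : ContMDiffOn 𝓘(ℝ, E) 𝓘(ℝ, ℝ) ∞ g U) : ∃ F : SmoothFun E M, F =ᶠ[𝓝 z] g := by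
  obtain ⟨χ, -, hχ⟩ := (SmoothBumpFunction.nhds_basis_tsupport (I := 𝓘(ℝ, E)) z).mem_iff.1
    (hU.mem_nhds hz)
  refine ⟨⟨fun x => χ x • g x, contMDiff_of_tsupport fun x hx => ?_⟩, ?_⟩
  · have hxU : x ∈ U := hχ (tsupport_smul_subset_left χ g hx)
    exact χ.contMDiffAt.smul (hg.contMDiffAt (hU.mem_nhds hxU))
  · filter_upwards [χ.eventuallyEq_one] with x hx
    simp [hx]

lemma contMDiffOn_extChartAt_self [IsManifold 𝓘(ℝ, E) ∞ M] (z : M) :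
    ContMDiffOn 𝓘(ℝ, E) 𝓘(ℝ, E) ∞ (extChartAt 𝓘(ℝ, E) z) (extChartAt 𝓘(ℝ, E) z).source := by
  rw [extChartAt_source]
  exact contMDiffOn_extChartAt

lemma SmoothFun.contDiffOn_comp_extChartAt_symm [IsManifold 𝓘(ℝ, E) ∞ M] (F : SmoothFun E M)
    (z : M) : ContDiffOn ℝ ∞ (fun y => F ((extChartAt 𝓘(ℝ, E) z).symm y))
      (extChartAt 𝓘(ℝ, E) z).target :=
  contMDiffOn_iff_contDiffOn.1
    (F.contMDiff.comp_contMDiffOn (contMDiffOn_extChartAt_symm z))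

lemma differential_eq_fderiv (F : SmoothFun E M) (z : M) :
    differential F z = fderiv ℝ (fun y => F ((extChartAt 𝓘(ℝ, E) z).symm y))
      (extChartAt 𝓘(ℝ, E) z z) := by
  rw [differential, (F.mdifferentiableAt z).mfderiv]
  simp only [writtenInExtChartAt, mfld_simps, fderivWithin_univ]
  rfl

lemma differential_eq_of_eventuallyEq_comp_extChartAt {F : SmoothFun E M} {z : M} {f : E → ℝ}
    (h : ∀ᶠ x in 𝓝 z, F x = f (extChartAt 𝓘(ℝ, E) z x)) :
    differential F z = fderiv ℝ f (extChartAt 𝓘(ℝ, E) z z) := by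
  rw [differential_eq_fderiv]
  refine Filter.EventuallyEq.fderiv_eq ?_
  have h1 := (continuousAt_extChartAt_symm (I := 𝓘(ℝ, E)) z).tendsto
  rw [extChartAt_to_inv z] at h1
  filter_upwards [h1.eventually h, extChartAt_target_mem_nhds (I := 𝓘(ℝ, E)) z] with y hy hyt
  rw [hy, (extChartAt 𝓘(ℝ, E) z).right_inv hyt]

variable [FiniteDimensional ℝ E] [T2Space M] [IsManifold 𝓘(ℝ, E) ∞ M]

/-- A smooth function of the coordinates in the preferred chart at `z` extends to `M` from a
neighbourhood of `z`. -/
lemma exists_smoothFun_eventuallyEq_comp_extChartAt (z : M) {f : E → ℝ} (hf : ContDiff ℝ ∞ f) :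
    ∃ F : SmoothFun E M, ∀ᶠ x in 𝓝 z, F x = f (extChartAt 𝓘(ℝ, E) z x) :=
  exists_smoothFun_eventuallyEq (isOpen_extChartAt_source z) (mem_extChartAt_source z)
    (hf.contMDiff.comp_contMDiffOn (contMDiffOn_extChartAt_self z))

lemma tangentVector_ext {z : M} {v w : TangentSpace 𝓘(ℝ, E) z}
    (h : ∀ F : SmoothFun E M, differential F z v = differential F z w) : v = w := by
  refine (Module.finBasis ℝ E).ext_elem fun i => ?_
  let l := ((Module.finBasis ℝ E).coord i).toContinuousLinearMap
  obtain ⟨F, hF⟩ := exists_smoothFun_eventuallyEq_comp_extChartAt z l.contDiff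
  have h1 := h F
  rw [differential_eq_of_eventuallyEq_comp_extChartAt hF, l.fderiv] at h1
  exact h1

section PointDerivation

variable {z : M} {D : SmoothFun E M →ₗ[ℝ] ℝ}
  (hD : ∀ F G : SmoothFun E M, D (F * G) = F z * D G + G z * D F)
include hD

omit [FiniteDimensional ℝ E] [T2Space M] [IsManifold 𝓘(ℝ, E) ∞ M] in
lemma pointDerivation_one : D 1 = 0 := by
  have h := hD 1 1
  simp only [mul_one, ContMDiffMap.coe_one, Pi.one_apply, one_mul] at h
  linarith

/-- Take a bump function χ supported where F vanishes: 0 = D(χF) = χ(z) D F + F(z) D χ = D F. -/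
lemma pointDerivation_eq_zero_of_eventuallyEq_zero {F : SmoothFun E M} (hF : ∀ᶠ x in 𝓝 z, F x = 0) :
    D F = 0 := by
  obtain ⟨χ, -, hχ⟩ := (SmoothBumpFunction.nhds_basis_support (I := 𝓘(ℝ, E)) hF).mem_iff.1 hF
  let X : SmoothFun E M := ⟨χ, χ.contMDiff⟩
  have h0 : X * F = 0 := by
    ext x
    change χ x * F x = 0
    by_cases hx : χ x = 0
    · simp [hx]
    · have : F x = 0 := hχ hx
      simp [this]
  have h1 := hD X F
  have h2 : X z = 1 := χ.eq_one
  rw [h0, map_zero, h2, hF.self_of_nhds] at h1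
  linarith

/-- A derivation at a point of the algebra of smooth functions is a tangent vector. -/
lemma exists_tangentVector_of_pointDerivation :
    ∃ v : TangentSpace 𝓘(ℝ, E) z, ∀ F : SmoothFun E M, differential F z v = D F := by
  set e := extChartAt 𝓘(ℝ, E) z
  set x₀ := e z
  set b := Module.finBasis ℝ E
  have hX : ∀ i, ∃ X : SmoothFun E M, ∀ᶠ x in 𝓝 z, X x = b.coord i (e x - x₀) := fun i =>
    exists_smoothFun_eventuallyEq_comp_extChartAt z (f := fun y => b.coord i (y - x₀))
      ((b.coord i).toContinuousLinearMap.contDiff.comp (contDiff_id.sub contDiff_const))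
  choose X hX using hX
  -- The components of the vector are the values of `D` on the coordinate functions, extended to
  -- `M`.
  refine ⟨(∑ i, D (X i) • b i : E), fun F => ?_⟩
  obtain ⟨f, hf⟩ := exists_smoothFun_eventuallyEq (E := E) (M := E)
    (isOpen_extChartAt_target (I := 𝓘(ℝ, E)) z) (mem_extChartAt_target (I := 𝓘(ℝ, E)) z)
    (contMDiffOn_iff_contDiffOn.2 (F.contDiffOn_comp_extChartAt_symm z))
  obtain ⟨g, hg, hg₀, hfg⟩ :=
    f.contMDiff.contDiff.exists_eq_add_sum_coord_mul b x₀
  have hFf : ∀ᶠ x in 𝓝 z, F x = f (e x) := by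
    filter_upwards [(continuousAt_extChartAt (I := 𝓘(ℝ, E)) z).eventually hf,
      extChartAt_source_mem_nhds (I := 𝓘(ℝ, E)) z] with x hx hxs
    rw [hx, (extChartAt 𝓘(ℝ, E) z).left_inv hxs]
  have hG : ∀ i, ∃ G : SmoothFun E M, ∀ᶠ x in 𝓝 z, G x = g i (e x) := fun i =>
    exists_smoothFun_eventuallyEq_comp_extChartAt z (hg i)
  choose G hG using hG
  -- By Hadamard's lemma `F` is near `z` a constant plus `∑ i, X i * G i`. Since `X i` vanishes at
  -- `z`, the Leibniz rule leaves only the terms `G i z * D (X i)`, and `G i z` is the `i`-th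
  -- partial derivative.
  have h0 : D (F - (f x₀ • 1 + ∑ i, X i * G i)) = 0 := by
    refine pointDerivation_eq_zero_of_eventuallyEq_zero hD ?_
    filter_upwards [hFf, eventually_all.2 hX, eventually_all.2 hG] with x h1 h2 h3
    have h4 : (∑ i, X i * G i : SmoothFun E M) x = ∑ i, X i x * G i x := by
      rw [← ContMDiffMap.coeFnAddMonoidHom_apply, map_sum, Finset.sum_apply]
      rfl
    change F x - (f x₀ * 1 + (∑ i, X i * G i : SmoothFun E M) x) = 0
    rw [h1, hfg, h4]
    simp_rw [h2, h3]
    rw [mul_one, sub_self]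
  rw [map_sub, sub_eq_zero, map_add, map_smul, pointDerivation_one hD, map_sum, smul_zero,
    zero_add] at h0
  rw [differential_eq_of_eventuallyEq_comp_extChartAt hFf, h0]
  change (fderiv ℝ f x₀ : E →L[ℝ] ℝ) (∑ i, D (X i) • b i) = _
  rw [map_sum]
  refine Finset.sum_congr rfl fun i _ => ?_
  have h5 : X i z = 0 := by rw [(hX i).self_of_nhds]; simp [x₀]
  have h6 : G i z = g i x₀ := (hG i).self_of_nhds
  rw [map_smul, hD, h5, zero_mul, zero_add, h6, hg₀, smul_eq_mul, mul_comm]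

end PointDerivation

omit [FiniteDimensional ℝ E] [T2Space M] [IsManifold 𝓘(ℝ, E) ∞ M] in
-- The field is defined by choice, so its defining identity is available only once a suitable vector
-- is known to exist.
lemma differential_hamiltonianVectorField {br : SmoothFun E M → SmoothFun E M → M → ℝ}
    {H : SmoothFun E M} {z : M}
    (h : ∃ v : TangentSpace 𝓘(ℝ, E) z, ∀ F : SmoothFun E M, differential F z v = br F H z)
    (F : SmoothFun E M) : differential F z (hamiltonianVectorField br H z) = br F H z :=
  @Classical.epsilon_spec _
    (fun v : TangentSpace 𝓘(ℝ, E) z => ∀ F : SmoothFun E M, differential F z v = br F H z) h F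

namespace PoissonStructure

lemma differential_hamVF (π : PoissonStructure E M) (H F : SmoothFun E M) (z : M) :
    differential F z (π.hamVF H z) = π.bracket F H z := by
  refine differential_hamiltonianVectorField
    (exists_tangentVector_of_pointDerivation (D :=
      { toFun := fun F => π.bracket F H z
        map_add' := fun F G => by simp
        map_smul' := fun c F => by simp }) fun F G => ?_) F
  change π.bracket (F * G) H z = F z * π.bracket G H z + G z * π.bracket F H z
  rw [π.leibniz]
  rfl

omit [FiniteDimensional ℝ E] [T2Space M] [IsManifold 𝓘(ℝ, E) ∞ M] in
lemma bracket_swap (π : PoissonStructure E M) (F G : SmoothFun E M) :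
    π.bracket F G = -π.bracket G F := by
  have h := π.bracket_self (F + G)
  simp only [map_add, LinearMap.add_apply, π.bracket_self, zero_add, add_zero] at h
  exact eq_neg_of_add_eq_zero_right h

end PoissonStructure

end TangentVectors

/-! ### The Hamiltonian flow in a chart -/

section ChartFlow

open Set Filter

variable {E : Type*} [NormedAddCommGroup E] [NormedSpace ℝ E] [FiniteDimensional ℝ E]
  {M : Type*} [TopologicalSpace M] [T2Space M] [ChartedSpace E M] [IsManifold 𝓘(ℝ, E) ∞ M]

omit [FiniteDimensional ℝ E] in
lemma comp_one_smulRight_eq {E' : Type*} [NormedAddCommGroup E'] [NormedSpace ℝ E']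
    {L : E →L[ℝ] E'} {v : E} {w : E'} (h : L v = w) :
    L.comp ((1 : ℝ →L[ℝ] ℝ).smulRight v) = (1 : ℝ →L[ℝ] ℝ).smulRight w := by
  ext
  simpa using h

/-- The representative of a Hamiltonian vector field in the preferred chart at `z₀` is, near `z₀`,
the restriction of a compactly supported smooth vector field on the model space. -/
lemma PoissonStructure.exists_chart_representative (π : PoissonStructure E M) (H : SmoothFun E M)
    (z₀ : M) : ∃ w : E → E, ContDiff ℝ 1 w ∧ HasCompactSupport w ∧
      ∃ N : Set M, IsOpen N ∧ z₀ ∈ N ∧ N ⊆ (extChartAt 𝓘(ℝ, E) z₀).source ∧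
        ∀ z ∈ N, mfderiv 𝓘(ℝ, E) 𝓘(ℝ, E) (extChartAt 𝓘(ℝ, E) z₀) z (π.hamVF H z) =
          w (extChartAt 𝓘(ℝ, E) z₀ z) := by
  set e := extChartAt 𝓘(ℝ, E) z₀
  set b := Module.finBasis ℝ E
  let l : Fin (Module.finrank ℝ E) → E →L[ℝ] ℝ := fun i => (b.coord i).toContinuousLinearMap
  have hX : ∀ i, ∃ X : SmoothFun E M, ∀ᶠ x in 𝓝 z₀, X x = l i (e x) := fun i =>
    exists_smoothFun_eventuallyEq_comp_extChartAt z₀ (l i).contDiff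
  choose X hX using hX
  obtain ⟨N₁, hN₁X, hN₁o, hN₁z⟩ := eventually_nhds_iff.1 (eventually_all.2 hX)
  have htarget : e.target ∈ 𝓝 (e z₀) := extChartAt_target_mem_nhds z₀
  obtain ⟨ε, hε, hball⟩ := Metric.nhds_basis_closedBall.mem_iff.1 htarget
  let ψ : ContDiffBump (e z₀) := ⟨ε / 2, ε, by positivity, by linarith⟩
  -- In the chart the components of X_H are `dX_i(X_H) = {X_i, H}`, which are smooth. The cutoff `ψ`
  -- is 1 near `e z₀` and supported inside the chart target.
  let w : E → E := fun y => ψ y • ∑ i, π.bracket (X i) H (e.symm y) • b i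
  have hts : tsupport w ⊆ Metric.closedBall (e z₀) ε :=
    (tsupport_smul_subset_left ψ _).trans ψ.tsupport_eq.subset
  refine ⟨w, ?_, ?_, N₁ ∩ (e.source ∩ e ⁻¹' Metric.ball (e z₀) (ε / 2)), ?_, ?_, ?_, ?_⟩
  · refine contMDiff_iff_contDiff.1 (contMDiff_of_tsupport fun y hy => ?_)
    have hyt : e.target ∈ 𝓝 y := (isOpen_extChartAt_target z₀).mem_nhds (hball (hts hy))
    refine (ψ.contDiff.contDiffAt.smul ?_).contMDiffAt
    refine ContDiffAt.sum fun i _ => ContDiffAt.smul ?_ contDiffAt_const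
    exact ((((π.bracket (X i) H).contDiffOn_comp_extChartAt_symm z₀).contDiffAt hyt).of_le
      (by norm_cast))
  · exact (isCompact_closedBall _ _).of_isClosed_subset (isClosed_tsupport w) hts
  · exact hN₁o.inter ((continuousOn_extChartAt z₀).isOpen_inter_preimage
      (isOpen_extChartAt_source z₀) Metric.isOpen_ball)
  · exact ⟨hN₁z, mem_extChartAt_source z₀, Metric.mem_ball_self (by positivity)⟩
  · exact fun z hz => hz.2.1
  · rintro z ⟨hz₁, hzs, hzb⟩
    have hψ : ψ (e z) = 1 := ψ.one_of_mem_closedBall (Metric.ball_subset_closedBall hzb)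
    refine b.ext_elem fun i => ?_
    have h1 : differential (X i) z (π.hamVF H z) = π.bracket (X i) H z :=
      π.differential_hamVF H (X i) z
    have h2 : X i =ᶠ[𝓝 z] l i ∘ e := by
      filter_upwards [hN₁o.mem_nhds hz₁] with x hx using hN₁X x hx i
    have h3 : HasMFDerivAt 𝓘(ℝ, E) 𝓘(ℝ, E) e z (mfderiv 𝓘(ℝ, E) 𝓘(ℝ, E) e z) :=
      (mdifferentiableAt_extChartAt ((extChartAt_source 𝓘(ℝ, E) z₀).subset hzs)).hasMFDerivAt
    have h4 := ((l i).hasMFDerivAt (x := e z)).comp z h3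
    have h5 : differential (X i) z = (l i).comp (mfderiv 𝓘(ℝ, E) 𝓘(ℝ, E) e z) :=
      h2.mfderiv_eq.trans h4.mfderiv
    rw [h5] at h1
    have h6 : b.repr (w (e z)) i = π.bracket (X i) H z := by
      simp only [w, hψ, one_smul, e.left_inv hzs, b.repr_sum_self]
    rw [h6]
    exact h1

/-- Near every point the flow of a Hamiltonian vector field is, in the preferred chart,
the restriction of a global flow on the model space. -/
lemma PoissonStructure.exists_chart_flow (π : PoissonStructure E M) (H : SmoothFun E M) (z₀ : M) :
    ∃ N : Set M, IsOpen N ∧ z₀ ∈ N ∧ N ⊆ (extChartAt 𝓘(ℝ, E) z₀).source ∧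
      ∀ z, ∃ η : ℝ → E, Continuous η ∧ η 0 = extChartAt 𝓘(ℝ, E) z₀ z ∧
        ∀ t, η t ∈ extChartAt 𝓘(ℝ, E) z₀ '' N →
          HasMFDerivAt 𝓘(ℝ, ℝ) 𝓘(ℝ, E) ((extChartAt 𝓘(ℝ, E) z₀).symm ∘ η) t
            ((1 : ℝ →L[ℝ] ℝ).smulRight (π.hamVF H ((extChartAt 𝓘(ℝ, E) z₀).symm (η t)))) := by
  obtain ⟨w, hw, hwc, N, hNo, hzN, hNs, hN⟩ := π.exists_chart_representative H z₀
  set e := extChartAt 𝓘(ℝ, E) z₀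
  refine ⟨N, hNo, hzN, hNs, fun z => ?_⟩
  obtain ⟨η, hη0, hη⟩ := hw.exists_forall_hasDerivAt_of_hasCompactSupport hwc (e z)
  refine ⟨η, continuous_iff_continuousAt.2 fun t => (hη t).continuousAt, hη0, ?_⟩
  rintro t ⟨y, hy, hyt⟩
  have hys : y ∈ e.source := hNs hy
  have hηt : η t ∈ e.target := hyt ▸ e.map_source hys
  have hyη : e.symm (η t) = y := by rw [← hyt, e.left_inv hys]
  have h1 : HasMFDerivAt 𝓘(ℝ, ℝ) 𝓘(ℝ, E) η t ((1 : ℝ →L[ℝ] ℝ).smulRight (w (η t))) := by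
    have h0 : HasFDerivAt η ((1 : ℝ →L[ℝ] ℝ).smulRight (w (η t))) t :=
      (hη t).hasFDerivAt.congr_fderiv (by ext; simp)
    exact h0.hasMFDerivAt
  have h2 : MDifferentiableAt 𝓘(ℝ, E) 𝓘(ℝ, E) e.symm (η t) :=
    ((contMDiffOn_extChartAt_symm (n := ∞) z₀).contMDiffAt
      ((isOpen_extChartAt_target z₀).mem_nhds hηt)).mdifferentiableAt (by simp)
  refine (h2.hasMFDerivAt.comp t h1).congr_mfderiv ?_
  have h3 := mfderivWithin_extChartAt_symm_comp_mfderiv_extChartAt (I := 𝓘(ℝ, E)) hηt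
  have h4 := hN y hy
  have h5 := DFunLike.congr_fun h3 (π.hamVF H (e.symm (η t)))
  have h6 : mfderiv 𝓘(ℝ, E) 𝓘(ℝ, E) e (e.symm (η t)) (π.hamVF H (e.symm (η t))) = w (η t) := by
    rw [hyη, h4, hyt]
  have h7 : mfderiv 𝓘(ℝ, E) 𝓘(ℝ, E) e.symm (η t) (w (η t)) = π.hamVF H (e.symm (η t)) := by
    rw [← h6, ← mfderivWithin_univ, ← range_id]
    exact h5
  exact comp_one_smulRight_eq (E := E) (E' := E) h7

end ChartFlow

/-! ### Invariance of the vanishing set under Hamiltonian flows -/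

section PoissonIdeal

open Set Filter

variable {E : Type*} [NormedAddCommGroup E] [NormedSpace ℝ E]
  {M : Type*} [TopologicalSpace M] [ChartedSpace E M]

lemma mem_vanishingSet_span_range {κ : Type*} {G : κ → SmoothFun E M} {z : M} :
    z ∈ vanishingSet (Ideal.span (range G)) ↔ ∀ k, G k z = 0 := by
  refine ⟨fun h k => h _ (Ideal.subset_span ⟨k, rfl⟩), fun h f hf => ?_⟩
  induction hf using Submodule.span_induction with
  | mem x hx => obtain ⟨k, rfl⟩ := hx; exact h k
  | zero => rfl
  | add x y _ _ hx hy =>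
    change x z + y z = 0
    rw [hx, hy, add_zero]
  | smul a x _ hx =>
    change a z * x z = 0
    rw [hx, mul_zero]

lemma ContMDiffMap.finsetSum_apply {κ : Type*} (s : Finset κ) (f : κ → SmoothFun E M) (z : M) :
    (∑ i ∈ s, f i) z = ∑ i ∈ s, f i z := by
  rw [← ContMDiffMap.coeFnAddMonoidHom_apply, map_sum, Finset.sum_apply]
  rfl

lemma isOpen_extChartAt_image {z : M} {N : Set M} (hN : IsOpen N)
    (hNs : N ⊆ (extChartAt 𝓘(ℝ, E) z).source) : IsOpen (extChartAt 𝓘(ℝ, E) z '' N) := by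
  rw [(extChartAt 𝓘(ℝ, E) z).image_eq_target_inter_inv_preimage hNs]
  exact (continuousOn_extChartAt_symm z).isOpen_inter_preimage (isOpen_extChartAt_target z) hN

variable [FiniteDimensional ℝ E] [T2Space M] [IsManifold 𝓘(ℝ, E) ∞ M]

lemma IsMIntegralCurveOn.hasDerivWithinAt_smoothFun {π : PoissonStructure E M} {H : SmoothFun E M}
    {γ : ℝ → M} {s : Set ℝ} (hγ : IsMIntegralCurveOn γ (π.hamVF H) s) (F : SmoothFun E M) {t : ℝ}
    (ht : t ∈ s) : HasDerivWithinAt (fun t => F (γ t)) (π.bracket F H (γ t)) s t := by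
  have h1 := (F.hasMFDerivAt (γ t)).comp_hasMFDerivWithinAt t (hγ t ht)
  have h2 : HasFDerivWithinAt (fun t => F (γ t)) ((1 : ℝ →L[ℝ] ℝ).smulRight
      (differential F (γ t) (π.hamVF H (γ t)))) s t := by
    refine (hasMFDerivWithinAt_iff_hasFDerivWithinAt.1 h1).congr_fderiv ?_
    exact comp_one_smulRight_eq (E := E) (E' := ℝ) rfl
  simpa [π.differential_hamVF H F (γ t)] using h2.hasDerivWithinAt

/-- The flow of a Hamiltonian vector field preserves the vanishing set of a finitely generated
Poisson ideal. -/
lemma IsPoissonIdeal.mem_vanishingSet_of_isMIntegralCurveOn {π : PoissonStructure E M} {m : ℕ}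
    {G : Fin m → SmoothFun E M} (hI : IsPoissonIdeal π (Ideal.span (range G))) {H : SmoothFun E M}
    {γ : ℝ → M} {T : ℝ} (hγ : IsMIntegralCurveOn γ (π.hamVF H) (Icc 0 T))
    (h0 : γ 0 ∈ vanishingSet (Ideal.span (range G))) {t : ℝ} (ht : t ∈ Icc 0 T) :
    γ t ∈ vanishingSet (Ideal.span (range G)) := by
  -- The ideal is Poisson and finitely generated, so along `γ` the generators satisfy a linear ODE
  -- with coefficients `a k l`.
  have ha : ∀ k, ∃ a : Fin m → SmoothFun E M, ∑ l, a l * G l = π.bracket (G k) H := fun k => by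
    rw [← Ideal.mem_span_range_iff_exists_fun, π.bracket_swap]
    exact neg_mem (hI H _ (Ideal.subset_span ⟨k, rfl⟩))
  choose a ha using ha
  have hcont : ContinuousOn γ (Icc 0 T) := fun t ht => (hγ t ht).continuousWithinAt
  -- `K` bounds the sum of all coefficients, hence every row sum: the operator norm for the sup norm
  -- on `Fin m → ℝ`.
  obtain ⟨K, hK⟩ := isCompact_Icc.exists_bound_of_continuousOn
    (f := fun t => ∑ k, ∑ l, |a k l (γ t)|) (s := Icc 0 T) (by
      refine continuousOn_finsetSum _ fun k _ => continuousOn_finsetSum _ fun l _ => ?_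
      exact ((a k l).contMDiff.continuous.comp_continuousOn hcont).abs)
  have hderiv : ∀ t ∈ Icc 0 T, HasDerivWithinAt (fun t k => G k (γ t))
      (fun k => π.bracket (G k) H (γ t)) (Icc 0 T) t := fun t ht =>
    hasDerivWithinAt_pi.2 fun k => hγ.hasDerivWithinAt_smoothFun (G k) ht
  have hzero := eq_zero_of_abs_deriv_le_mul_abs_self_of_eq_zero_right (K := K)
    (f := fun t k => G k (γ t)) (f' := fun t k => π.bracket (G k) H (γ t)) (a := 0) (b := T)
    (fun t ht => (hderiv t ht).continuousWithinAt)
    (fun t ht => (hderiv t (Ico_subset_Icc_self ht)).mono_of_mem_nhdsWithin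
      (Icc_mem_nhdsGE_of_mem ht))
    (funext (mem_vanishingSet_span_range.1 h0)) (fun t ht => by
      have hKt := hK t (Ico_subset_Icc_self ht)
      rw [Real.norm_of_nonneg (by positivity)] at hKt
      refine (pi_norm_le_iff_of_nonneg (mul_nonneg (le_trans (by positivity) hKt)
        (norm_nonneg _))).2 fun k => ?_
      rw [← ha k, ContMDiffMap.finsetSum_apply]
      calc ‖∑ l, (a k l * G l : SmoothFun E M) (γ t)‖
          ≤ ∑ l, |a k l (γ t)| * ‖fun k => G k (γ t)‖ := by
            refine norm_sum_le_of_le _ fun l _ => ?_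
            change ‖a k l (γ t) * G l (γ t)‖ ≤ _
            rw [norm_mul]
            exact mul_le_mul_of_nonneg_left (norm_le_pi_norm (fun k => G k (γ t)) l)
              (norm_nonneg _)
        _ = (∑ l, |a k l (γ t)|) * ‖fun k => G k (γ t)‖ := by rw [Finset.sum_mul]
        _ ≤ K * ‖fun k => G k (γ t)‖ := by
            refine mul_le_mul_of_nonneg_right (le_trans ?_ hKt) (norm_nonneg _)
            exact Finset.single_le_sum (f := fun k => ∑ l, |a k l (γ t)|)
              (fun k _ => by positivity) (Finset.mem_univ k))
  exact mem_vanishingSet_span_range.2 fun k => congrFun (hzero t ht) k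

lemma PoissonStructure.exists_isMIntegralCurveOn_Icc (π : PoissonStructure E M) (H : SmoothFun E M)
    (z : M) : ∃ γ : ℝ → M, ∃ T > 0, γ 0 = z ∧ IsMIntegralCurveOn γ (π.hamVF H) (Icc 0 T) := by
  obtain ⟨N, hNo, hzN, hNs, hN⟩ := π.exists_chart_flow H z
  obtain ⟨η, hηc, hη0, hη⟩ := hN z
  set e := extChartAt 𝓘(ℝ, E) z
  have hopen : IsOpen (e '' N) := isOpen_extChartAt_image hNo hNs
  have h0 : ∀ᶠ t in 𝓝 (0 : ℝ), η t ∈ e '' N := by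
    refine hηc.continuousAt.eventually (hopen.mem_nhds ?_)
    rw [hη0]
    exact mem_image_of_mem _ hzN
  obtain ⟨T, hT, hball⟩ := Metric.nhds_basis_closedBall.mem_iff.1 h0
  refine ⟨e.symm ∘ η, T, hT, ?_, fun t ht => (hη t (hball ?_)).hasMFDerivWithinAt⟩
  · rw [Function.comp_apply, hη0, extChartAt_to_inv]
  · rw [Metric.mem_closedBall, Real.dist_0_eq_abs, abs_of_nonneg ht.1]
    exact ht.2

/-- A function vanishing on the vanishing set of a finitely generated Poisson ideal near one of its
points commutes there with every function. -/
lemma IsPoissonIdeal.bracket_eq_zero_of_eventually_eq_zero {π : PoissonStructure E M} {m : ℕ}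
    {G : Fin m → SmoothFun E M} (hI : IsPoissonIdeal π (Ideal.span (range G))) {s : M}
    (hs : s ∈ vanishingSet (Ideal.span (range G))) {F : SmoothFun E M}
    (hF : ∀ᶠ z in 𝓝 s, z ∈ vanishingSet (Ideal.span (range G)) → F z = 0) (H : SmoothFun E M) :
    π.bracket F H s = 0 := by
  -- The integral curve of `H` from `s` stays in the vanishing set, so `F` is zero along it for
  -- small times; its one-sided derivative at time 0 is {F, H}(s).
  obtain ⟨γ, T, hT, rfl, hγ⟩ := π.exists_isMIntegralCurveOn_Icc H s
  have hmem : (0 : ℝ) ∈ Icc 0 T := left_mem_Icc.2 hT.le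
  have h1 := hγ.hasDerivWithinAt_smoothFun F hmem
  have h2 : (fun t => F (γ t)) =ᶠ[𝓝[Icc 0 T] 0] fun _ => 0 := by
    filter_upwards [(hγ 0 hmem).continuousWithinAt.eventually hF, self_mem_nhdsWithin] with t ht htT
    exact ht (hI.mem_vanishingSet_of_isMIntegralCurveOn hγ hs htT)
  exact (uniqueDiffOn_Icc hT 0 hmem).eq_deriv _ h1
    ((hasDerivWithinAt_const 0 _ _).congr_of_eventuallyEq_of_mem h2 hmem)

end PoissonIdeal

/-! ### The reduced bracket and the reduced vector field on the submanifold -/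

section Reduction

open Set Filter

variable {E : Type*} [NormedAddCommGroup E] [NormedSpace ℝ E]
  {P : Type*} [TopologicalSpace P] [ChartedSpace E P]
  {E' : Type*} [NormedAddCommGroup E'] [NormedSpace ℝ E']
  {S : Type*} [TopologicalSpace S] [ChartedSpace E' S]

/-- `ρ` is a smooth left inverse of `ι` on the neighbourhood `N` of `ι s`. -/
structure IsLocalRetraction (ι : C^∞⟮𝓘(ℝ, E'), S; 𝓘(ℝ, E), P⟯) (s : S) (ρ : P → S) (N : Set P) :
    Prop where
  isOpen : IsOpen N
  mem : ι s ∈ N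
  contMDiffOn : ContMDiffOn 𝓘(ℝ, E) 𝓘(ℝ, E') ∞ ρ N
  left_inv : ∀ s', ι s' ∈ N → ρ (ι s') = s'

/-- In charts adapted to the immersion, ι is x ↦ (x, 0); the retraction is the projection to the
first factor. -/
lemma Manifold.IsSmoothEmbedding.exists_isLocalRetraction
    [IsManifold 𝓘(ℝ, E) ∞ P] [IsManifold 𝓘(ℝ, E') ∞ S]
    {ι : C^∞⟮𝓘(ℝ, E'), S; 𝓘(ℝ, E), P⟯}
    (hι : Manifold.IsSmoothEmbedding 𝓘(ℝ, E') 𝓘(ℝ, E) ∞ ι) (s : S) :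
    ∃ ρ N, IsLocalRetraction ι s ρ N := by
  have h := hι.isImmersion.isImmersionAt s
  set φ := h.domChart
  set ψ := h.codChart
  let p : P → E' := fun z => (h.equiv.symm (ψ z)).1
  have hp : ∀ s' ∈ φ.source, p (ι s') = φ s' := by
    intro s' hs'
    have hmem : φ s' ∈ (φ.extend 𝓘(ℝ, E')).target := by
      simpa using φ.map_source hs'
    have h1 := h.writtenInCharts hmem
    simp only [Function.comp_apply, OpenPartialHomeomorph.extend_coe,
      OpenPartialHomeomorph.extend_coe_symm, modelWithCornersSelf_coe,
      modelWithCornersSelf_coe_symm, id_eq] at h1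
    have h2 : ψ (ι s') = h.equiv (φ s', 0) := by
      rw [← h1]
      exact congrArg (fun x => ψ (ι x)) (φ.left_inv hs').symm
    simp only [p, h2, ContinuousLinearEquiv.symm_apply_apply]
  have hps : ContMDiffOn 𝓘(ℝ, E) 𝓘(ℝ, E') ∞ p ψ.source := by
    have h1 : ContDiff ℝ ∞ fun y => (h.equiv.symm y).1 :=
      contDiff_fst.comp h.equiv.symm.contDiff
    exact h1.contMDiff.comp_contMDiffOn (contMDiffOn_of_mem_maximalAtlas h.codChart_mem_maximalAtlas)
  -- Being an embedding, not just an immersion, matters here: distant parts of `S` must not re-enter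
  -- the neighbourhood, where `left_inv` would fail.
  obtain ⟨V, hV, hVs⟩ := (hι.isEmbedding.isInducing.nhds_eq_comap s ▸
    φ.open_source.mem_nhds h.mem_domChart_source : φ.source ∈ comap ι (𝓝 (ι s)))
  obtain ⟨U, hUV, hU, hsU⟩ := mem_nhds_iff.1 hV
  have hN : IsOpen (ψ.source ∩ p ⁻¹' φ.target) :=
    hps.continuousOn.isOpen_inter_preimage ψ.open_source φ.open_target
  refine ⟨fun z => φ.symm (p z), U ∩ (ψ.source ∩ p ⁻¹' φ.target), hU.inter hN,
    ⟨hsU, h.mem_codChart_source, ?_⟩, ?_, fun s' hs' => ?_⟩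
  · rw [mem_preimage, hp s h.mem_domChart_source]
    exact φ.map_source h.mem_domChart_source
  · exact (contMDiffOn_symm_of_mem_maximalAtlas h.domChart_mem_maximalAtlas).comp
      (hps.mono fun z hz => hz.2.1) fun z hz => hz.2.2
  · have h1 : s' ∈ φ.source := hVs (hUV hs'.1)
    change φ.symm (p (ι s')) = s'
    rw [hp s' h1, φ.left_inv h1]

variable {ι : C^∞⟮𝓘(ℝ, E'), S; 𝓘(ℝ, E), P⟯}

lemma isLocalExtension_comp (F : SmoothFun E P) (s : S) : IsLocalExtension ι (F.comp ι) s F :=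
  ⟨univ, isOpen_univ, mem_univ _, fun _ _ => rfl⟩

lemma mdifferentiableAt_inclusion (s : S) : MDifferentiableAt 𝓘(ℝ, E') 𝓘(ℝ, E) ι s :=
  ι.contMDiff.mdifferentiable (by simp) s

lemma differential_comp (F : SmoothFun E P) (s : S) (v : TangentSpace 𝓘(ℝ, E') s) :
    differential (F.comp ι) s v =
      differential F (ι s) (mfderiv 𝓘(ℝ, E') 𝓘(ℝ, E) ι s v) :=
  DFunLike.congr_fun
    (((F.hasMFDerivAt (ι s)).comp s (mdifferentiableAt_inclusion s).hasMFDerivAt).mfderiv) v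

namespace IsLocalRetraction

variable {s : S} {ρ : P → S} {N : Set P} (h : IsLocalRetraction ι s ρ N)
include h

lemma apply_self : ρ (ι s) = s := h.left_inv s h.mem

lemma mdifferentiableAt : MDifferentiableAt 𝓘(ℝ, E) 𝓘(ℝ, E') ρ (ι s) :=
  (h.contMDiffOn.contMDiffAt (h.isOpen.mem_nhds h.mem)).mdifferentiableAt (by simp)

/-- The differential of a local retraction at `ι s`, with values in `T_s S`. -/
noncomputable def tangentMap (_ : IsLocalRetraction ι s ρ N) :
    TangentSpace 𝓘(ℝ, E) (ι s) →L[ℝ] TangentSpace 𝓘(ℝ, E') s :=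
  (mfderiv 𝓘(ℝ, E) 𝓘(ℝ, E') ρ (ι s) : E →L[ℝ] E')

lemma hasMFDerivAt : HasMFDerivAt 𝓘(ℝ, E) 𝓘(ℝ, E') ρ (ι s) h.tangentMap :=
  h.mdifferentiableAt.hasMFDerivAt

lemma tangentMap_mfderiv (v : TangentSpace 𝓘(ℝ, E') s) :
    h.tangentMap (mfderiv 𝓘(ℝ, E') 𝓘(ℝ, E) ι s v) = v := by
  have h1 := h.hasMFDerivAt.comp s (mdifferentiableAt_inclusion (ι := ι) s).hasMFDerivAt
  have h2 : (ρ ∘ ι) =ᶠ[𝓝 s] id := by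
    filter_upwards [ι.contMDiff.continuous.continuousAt.eventually (h.isOpen.mem_nhds h.mem)]
      with s' hs' using h.left_inv s' hs'
  have h3 : mfderiv 𝓘(ℝ, E') 𝓘(ℝ, E') (ρ ∘ ι) s = mfderiv 𝓘(ℝ, E') 𝓘(ℝ, E') id s := h2.mfderiv_eq
  rw [mfderiv_id] at h3
  exact DFunLike.congr_fun (h1.mfderiv.symm.trans h3) v

/-- Functions on `S` extend locally through a local retraction. -/
lemma exists_isLocalExtension [FiniteDimensional ℝ E] [T2Space P] [IsManifold 𝓘(ℝ, E) ∞ P]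
    (f : SmoothFun E' S) : ∃ F : SmoothFun E P, IsLocalExtension ι f s F ∧
      ∀ v, differential F (ι s) v = differential f s (h.tangentMap v) := by
  obtain ⟨F, hF⟩ := exists_smoothFun_eventuallyEq h.isOpen h.mem
    (f.contMDiff.comp_contMDiffOn h.contMDiffOn)
  refine ⟨F, ?_, fun v => ?_⟩
  · obtain ⟨U, hUF, hU, hsU⟩ := eventually_nhds_iff.1 (hF.and (h.isOpen.mem_nhds h.mem))
    refine ⟨U, hU, hsU, fun s' hs' => ?_⟩
    rw [(hUF _ hs').1, Function.comp_apply, h.left_inv s' (hUF _ hs').2]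
  · have h1 : HasMFDerivAt 𝓘(ℝ, E') 𝓘(ℝ, ℝ) f (ρ (ι s)) (differential f s) := by
      rw [h.apply_self]
      exact f.hasMFDerivAt s
    exact DFunLike.congr_fun (hF.mfderiv_eq.trans (h1.comp (ι s) h.hasMFDerivAt).mfderiv) v

end IsLocalRetraction

lemma IsRegularVia.mem_vanishingSet {I : Ideal (SmoothFun E P)} (h : IsRegularVia I ι) (s : S) :
    ι s ∈ vanishingSet I :=
  h.range_eq ▸ mem_range_self s

lemma IsRegularVia.eventually_sub_eq_zero {I : Ideal (SmoothFun E P)} (h : IsRegularVia I ι)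
    {f : SmoothFun E' S} {s : S} {F₁ F₂ : SmoothFun E P} (h₁ : IsLocalExtension ι f s F₁)
    (h₂ : IsLocalExtension ι f s F₂) :
    ∀ᶠ z in 𝓝 (ι s), z ∈ vanishingSet I → (F₁ - F₂) z = 0 := by
  obtain ⟨U₁, hU₁, hs₁, h₁⟩ := h₁
  obtain ⟨U₂, hU₂, hs₂, h₂⟩ := h₂
  filter_upwards [hU₁.mem_nhds hs₁, hU₂.mem_nhds hs₂] with z hz₁ hz₂ hz
  rw [← h.range_eq] at hz
  obtain ⟨s', rfl⟩ := hz
  change F₁ (ι s') - F₂ (ι s') = 0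
  rw [← h₁ s' hz₁, ← h₂ s' hz₂, sub_self]

variable [FiniteDimensional ℝ E] [T2Space P] [IsManifold 𝓘(ℝ, E) ∞ P] [IsManifold 𝓘(ℝ, E') ∞ S]

variable {π : PoissonStructure E P} {m : ℕ} {G : Fin m → SmoothFun E P}
  (hI : IsPoissonIdeal π (Ideal.span (range G))) (hreg : IsRegularVia (Ideal.span (range G)) ι)
include hI hreg

omit [IsManifold 𝓘(ℝ, E') ∞ S] in
lemma bracket_eq_of_isLocalExtension_left {f : SmoothFun E' S} {s : S} {F₁ F₂ : SmoothFun E P}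
    (h₁ : IsLocalExtension ι f s F₁) (h₂ : IsLocalExtension ι f s F₂) (K : SmoothFun E P) :
    π.bracket F₁ K (ι s) = π.bracket F₂ K (ι s) := by
  have h := hI.bracket_eq_zero_of_eventually_eq_zero (hreg.mem_vanishingSet s)
    (hreg.eventually_sub_eq_zero h₁ h₂) K
  rw [map_sub, LinearMap.sub_apply] at h
  exact sub_eq_zero.1 h

omit [IsManifold 𝓘(ℝ, E') ∞ S] in
/-- The reduced bracket can be computed with arbitrary local extensions. -/
lemma reducedBracket_eq {f g : SmoothFun E' S} {s : S} {F K : SmoothFun E P}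
    (hF : IsLocalExtension ι f s F) (hK : IsLocalExtension ι g s K) :
    reducedBracket π ι f g s = π.bracket F K (ι s) := by
  have hex : ∃ c : ℝ, ∀ F K : SmoothFun E P,
      IsLocalExtension ι f s F → IsLocalExtension ι g s K → π.br F K (ι s) = c := by
    refine ⟨π.bracket F K (ι s), fun F' K' hF' hK' => ?_⟩
    have h1 := bracket_eq_of_isLocalExtension_left hI hreg hF' hF K'
    have h2 := bracket_eq_of_isLocalExtension_left hI hreg hK' hK F
    rw [π.bracket_swap K', π.bracket_swap K] at h2
    exact h1.trans (neg_injective h2)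
  exact (Classical.epsilon_spec hex F K hF hK).symm

/-- Existence is witnessed by projecting X_H with the differential of a local retraction ρ: if F
extends f ∘ ρ, then df(dρ X_H) = dF(X_H) = {F, H}. -/
lemma differential_reduced_hamiltonianVectorField (H : SmoothFun E P) (f : SmoothFun E' S) (s : S) :
    differential f s (hamiltonianVectorField (reducedBracket π ι) (H.comp ι) s) =
      reducedBracket π ι f (H.comp ι) s := by
  obtain ⟨ρ, N, hρ⟩ := hreg.isSmoothEmbedding.exists_isLocalRetraction s
  refine differential_hamiltonianVectorField ⟨hρ.tangentMap (π.hamVF H (ι s)), fun f => ?_⟩ f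
  obtain ⟨F, hF, hdF⟩ := hρ.exists_isLocalExtension f
  rw [reducedBracket_eq hI hreg hF (isLocalExtension_comp H s), ← hdF, π.differential_hamVF]

/-- The reduced Hamiltonian vector field is `ι`-related to the Hamiltonian vector field. -/
lemma mfderiv_reduced_hamiltonianVectorField (H : SmoothFun E P) (s : S) :
    mfderiv 𝓘(ℝ, E') 𝓘(ℝ, E) ι s
      (hamiltonianVectorField (reducedBracket π ι) (H.comp ι) s) = π.hamVF H (ι s) := by
  -- `F` is itself an extension of its restriction to `S`, so both vectors pair with `dF` to {F,
  -- H}(ι s).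
  refine tangentVector_ext fun F => ?_
  rw [← differential_comp, differential_reduced_hamiltonianVectorField hI hreg,
    reducedBracket_eq hI hreg (isLocalExtension_comp F s) (isLocalExtension_comp H s),
    π.differential_hamVF]

omit [IsManifold 𝓘(ℝ, E') ∞ S] in
/-- A sub-Casimir commutes with every function at the points of the vanishing submanifold. -/
lemma IsSubCasimir.bracket_eq_zero {F : SmoothFun E P} (hF : IsSubCasimir π ι F)
    (K : SmoothFun E P) (s : S) : π.bracket F K (ι s) = 0 := by
  obtain ⟨c, hc, hFc⟩ := hF
  rw [← hc (K.comp ι) s]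
  exact (reducedBracket_eq hI hreg ⟨univ, isOpen_univ, mem_univ _, fun s' _ => (hFc s').symm⟩
    (isLocalExtension_comp K s)).symm

/-- Integral curves of the reduced Hamiltonian vector field are integral curves in `P`. -/
lemma isMIntegralCurveOn_inclusion_comp {H : SmoothFun E P} {σ : ℝ → S} {A : Set ℝ}
    (hσ : IsMIntegralCurveOn σ (hamiltonianVectorField (reducedBracket π ι) (H.comp ι)) A) :
    IsMIntegralCurveOn (ι ∘ σ) (π.hamVF H) A := fun t ht =>
  ((mdifferentiableAt_inclusion (σ t)).hasMFDerivAt.comp_hasMFDerivWithinAt t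
    (hσ t ht)).congr_mfderiv
      (comp_one_smulRight_eq (E := E') (E' := E)
        (mfderiv_reduced_hamiltonianVectorField hI hreg H (σ t)))

/-- Integral curves of the Hamiltonian vector field contained in the submanifold are integral
curves of the reduced Hamiltonian vector field. -/
lemma isMIntegralCurveOn_of_inclusion_comp {H : SmoothFun E P} {γ : ℝ → P} {σ : ℝ → S} {A : Set ℝ}
    (hγ : IsMIntegralCurveOn γ (π.hamVF H) A) (hσ : ∀ t ∈ A, ι (σ t) = γ t) :
    IsMIntegralCurveOn σ (hamiltonianVectorField (reducedBracket π ι) (H.comp ι)) A := by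
  intro t ht
  obtain ⟨ρ, N, hρ⟩ := hreg.isSmoothEmbedding.exists_isLocalRetraction (σ t)
  have h1 := hγ t ht
  let L : E →L[ℝ] E' := hρ.tangentMap
  -- The base point is generalized because `γ t` equals `ι (σ t)` only propositionally.
  have h2 : ∀ z, ι (σ t) = z → HasMFDerivAt 𝓘(ℝ, E) 𝓘(ℝ, E') ρ z L ∧
      L (π.hamVF H z) = hamiltonianVectorField (reducedBracket π ι) (H.comp ι) (σ t) := by
    rintro _ rfl
    refine ⟨hρ.hasMFDerivAt, ?_⟩
    rw [← hρ.tangentMap_mfderiv (hamiltonianVectorField (reducedBracket π ι) (H.comp ι) (σ t)),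
      mfderiv_reduced_hamiltonianVectorField hI hreg H (σ t)]
    rfl
  obtain ⟨h2, h3⟩ := h2 _ (hσ t ht)
  have hev : ∀ᶠ t' in 𝓝[A] t, γ t' ∈ N :=
    h1.continuousWithinAt.eventually (hρ.isOpen.mem_nhds (hσ t ht ▸ hρ.mem))
  -- No continuity of `σ` is assumed; its differentiability comes from this local formula.
  have h5 : σ =ᶠ[𝓝[A] t] ρ ∘ γ := by
    filter_upwards [hev, self_mem_nhdsWithin] with t' ht' htA
    rw [Function.comp_apply, ← hσ t' htA, hρ.left_inv _ (hσ t' htA ▸ ht')]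
  have h6 := (h2.comp_hasMFDerivWithinAt t h1).congr_of_eventuallyEq h5 (h5.eq_of_nhdsWithin ht)
  exact h6.congr_mfderiv (comp_one_smulRight_eq (E := E) (E' := E') h3)

end Reduction

/-! ### Trapping paths in a compact neighbourhood -/

section Trapping

open Set Filter

variable {X : Type*} [TopologicalSpace X]

/-- A compact neighbourhood of a strict local minimum, with a positive lower bound for the function
on its frontier. -/
lemma exists_isCompact_frontier_le [T2Space X] [LocallyCompactSpace X] {Φ : X → ℝ}
    (hΦ : Continuous Φ) {x : X} (hpos : ∀ᶠ y in 𝓝 x, y ≠ x → 0 < Φ y) {U : Set X} (hU : U ∈ 𝓝 x) :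
    ∃ K ∈ 𝓝 x, K ⊆ U ∧ IsCompact K ∧ ∃ c > 0, ∀ y ∈ frontier K, c ≤ Φ y := by
  obtain ⟨K, hK, hKU, hKc⟩ := local_compact_nhds (inter_mem hU hpos)
  refine ⟨K, hK, fun y hy => (hKU hy).1, hKc, ?_⟩
  have hfK : frontier K ⊆ K := hKc.isClosed.frontier_subset
  have hf : ∀ y ∈ frontier K, 0 < Φ y := fun y hy => (hKU (hfK hy)).2 (by
    rintro rfl
    exact hy.2 (mem_interior_iff_mem_nhds.2 hK))
  rcases (frontier K).eq_empty_or_nonempty with he | hne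
  · exact ⟨1, one_pos, by simp [he]⟩
  · obtain ⟨y, hy, hmin⟩ := (hKc.of_isClosed_subset isClosed_frontier hfK).exists_isMinOn hne
      hΦ.continuousOn
    exact ⟨Φ y, hf y hy, fun w hw => hmin hw⟩

/-- A path starting inside a closed set cannot leave it if it stays below the values taken by a
function on the frontier. -/
lemma mem_interior_of_forall_lt {K : Set X} (hK : IsClosed K) {Φ : X → ℝ} {c : ℝ}
    (hc : ∀ y ∈ frontier K, c ≤ Φ y) {γ : ℝ → X} {T : ℝ} (hγ : ContinuousOn γ (Icc 0 T))
    (h0 : γ 0 ∈ interior K) (hlt : ∀ t ∈ Icc 0 T, Φ (γ t) < c) {t : ℝ} (ht : t ∈ Icc 0 T) :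
    γ t ∈ interior K := by
  -- The path misses the frontier, so its connected image lies in one of these two disjoint open
  -- sets.
  have h1 : γ '' Icc 0 T ⊆ interior K ∪ Kᶜ := by
    rintro _ ⟨t, ht, rfl⟩
    by_contra h
    simp only [mem_union, not_or, notMem_compl_iff] at h
    exact (hlt t ht).not_ge (hc _ (hK.frontier_eq ▸ ⟨h.2, h.1⟩))
  refine (isPreconnected_Icc.image γ hγ).subset_left_of_subset_union isOpen_interior
    hK.isOpen_compl (disjoint_compl_right.mono_left interior_subset) h1
    ⟨γ 0, mem_image_of_mem _ (left_mem_Icc.2 (ht.1.trans ht.2)), h0⟩ (mem_image_of_mem _ ht)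

end Trapping

/-! ### Lyapunov's theorem and the strict local minimum -/

section Stability

open Set Filter

variable {E : Type*} [NormedAddCommGroup E] [NormedSpace ℝ E] [FiniteDimensional ℝ E]
  {P : Type*} [TopologicalSpace P] [T2Space P] [ChartedSpace E P] [IsManifold 𝓘(ℝ, E) ∞ P]

/-- **Lyapunov's theorem** relative to an invariant set `Z`: a function that is conserved along the
integral curves in `Z` and has a strict local minimum at `z_e` confines them near `z_e`. -/
theorem PoissonStructure.exists_nhds_forwardOrbitIn (π : PoissonStructure E P) (H : SmoothFun E P)
    {z_e : P} {Z : Set P} {Φ : P → ℝ} (hΦ : Continuous Φ) (hΦe : Φ z_e = 0)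
    (hpos : ∀ᶠ z in 𝓝 z_e, z ≠ z_e → 0 < Φ z)
    (hinv : ∀ (γ : ℝ → P) (T : ℝ), IsMIntegralCurveOn γ (π.hamVF H) (Icc 0 T) → γ 0 ∈ Z →
      ∀ t ∈ Icc 0 T, γ t ∈ Z ∧ Φ (γ t) = Φ (γ 0))
    {U : Set P} (hU : IsOpen U) (hzU : z_e ∈ U) :
    ∃ V : Set P, IsOpen V ∧ z_e ∈ V ∧
      ∀ z ∈ V ∩ Z, ForwardOrbitIn (π.hamVF H) z (U ∩ Z) := by
  have : LocallyCompactSpace P := Manifold.locallyCompact_of_finiteDimensional 𝓘(ℝ, E)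
  obtain ⟨N, hNo, hzN, hNs, hN⟩ := π.exists_chart_flow H z_e
  -- `K` is taken inside `N`, so that the global chart flow represents X_H as long as it stays in
  -- `K`.
  obtain ⟨K, hK, hKUN, hKc, c, hc, hcK⟩ :=
    exists_isCompact_frontier_le hΦ hpos ((hU.inter hNo).mem_nhds ⟨hzU, hzN⟩)
  refine ⟨interior K ∩ {z | Φ z < c}, isOpen_interior.inter (isOpen_lt hΦ continuous_const),
    ⟨mem_interior_iff_mem_nhds.2 hK, show Φ z_e < c by rwa [hΦe]⟩, ?_⟩
  rintro z ⟨⟨hzK, hzc⟩, hzZ⟩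
  have trap : ∀ (γ : ℝ → P) (T : ℝ), IsMIntegralCurveOn γ (π.hamVF H) (Icc 0 T) → γ 0 = z →
      ∀ t ∈ Icc 0 T, γ t ∈ interior K ∧ γ t ∈ Z := by
    rintro γ T hγ rfl t ht
    refine ⟨mem_interior_of_forall_lt hKc.isClosed hcK
      (fun t ht => (hγ t ht).continuousWithinAt) hzK (fun t ht => ?_) ht, (hinv γ T hγ hzZ t ht).1⟩
    rw [(hinv γ T hγ hzZ t ht).2]
    exact hzc
  constructor
  · obtain ⟨η, hηc, hη0, hη⟩ := hN z
    set e := extChartAt 𝓘(ℝ, E) z_e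
    have hKs : K ⊆ e.source := fun y hy => hNs (hKUN hy).2
    have hKint : interior K ⊆ K := interior_subset
    have hopen : IsOpen (e '' interior K) :=
      isOpen_extChartAt_image isOpen_interior (hKint.trans hKs)
    have hclosed : IsClosed (e '' K) :=
      (hKc.image_of_continuousOn ((continuousOn_extChartAt z_e).mono hKs)).isClosed
    have hKN : e '' K ⊆ e '' N := image_mono fun y hy => (hKUN hy).2
    have hγ0 : (e.symm ∘ η) 0 = z := by
      rw [Function.comp_apply, hη0, e.left_inv (hKs (hKint hzK))]
    have hη0K : η 0 ∈ e '' interior K := hη0 ▸ mem_image_of_mem e hzK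
    -- Let `T` be the first time outside the open image of `interior K`. Up to and including `T` the
    -- curve lies in the closed set `e '' K`, so it is an integral curve of X_H there, and `trap`
    -- puts it in the interior at time `T`: a contradiction.
    have hstay : ∀ t, 0 ≤ t → η t ∈ e '' interior K := by
      by_contra! hcon
      let B : Set ℝ := {t | 0 ≤ t ∧ η t ∉ e '' interior K}
      have hBne : B.Nonempty := hcon
      have hBbdd : BddBelow B := ⟨0, fun t ht => ht.1⟩
      have hBcl : IsClosed B := isClosed_Ici.inter (hopen.isClosed_compl.preimage hηc)
      have hT : sInf B ∈ B := hBcl.csInf_mem hBne hBbdd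
      set T := sInf B
      have hT0 : 0 ≠ T := fun h => hT.2 (h ▸ hη0K)
      have hlt : Ico 0 T ⊆ η ⁻¹' (e '' K) := fun t ht => by
        by_contra h
        exact (csInf_le hBbdd (show t ∈ B from ⟨ht.1, fun h' => h (image_mono hKint h')⟩)).not_gt
          ht.2
      have hle : Icc 0 T ⊆ η ⁻¹' (e '' K) := by
        rw [← closure_Ico hT0]
        exact (hclosed.preimage hηc).closure_subset_iff.2 hlt
      have hTmem : T ∈ Icc 0 T := right_mem_Icc.2 hT.1
      have h1 := (trap _ T (fun t ht => (hη t (hKN (hle ht))).hasMFDerivWithinAt) hγ0 T hTmem).1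
      obtain ⟨y, hy, hyT⟩ := hle hTmem
      rw [Function.comp_apply, ← hyT, e.left_inv (hKs hy)] at h1
      exact hT.2 ⟨y, h1, hyT⟩
    exact ⟨e.symm ∘ η, hγ0, fun t ht =>
      (hη t (hKN (image_mono hKint (hstay t ht)))).hasMFDerivWithinAt⟩
  · intro γ h0 hγ t ht
    have h1 := trap γ t (hγ.mono Icc_subset_Ici_self) h0 t (right_mem_Icc.2 ht.le)
    exact ⟨(hKUN (interior_subset h1.1)).1, h1.2⟩

omit [FiniteDimensional ℝ E] [T2Space P] in
lemma hessian_eq_fderiv_fderiv (F : SmoothFun E P) (z : P) (v w : E) :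
    hessian F z v w = fderiv ℝ (fderiv ℝ fun y => F ((extChartAt 𝓘(ℝ, E) z).symm y))
      (extChartAt 𝓘(ℝ, E) z z) v w := by
  have h1 : ContDiffAt ℝ 2 (fun y => F ((extChartAt 𝓘(ℝ, E) z).symm y))
      (extChartAt 𝓘(ℝ, E) z z) :=
    ((F.contDiffOn_comp_extChartAt_symm z).contDiffAt (extChartAt_target_mem_nhds z)).of_le
      (by norm_cast)
  have h2 := (h1.fderiv_right (m := 1) (by norm_num)).differentiableAt one_ne_zero
  change fderiv ℝ (fun x : E => fderiv ℝ (fun y : E => F ((extChartAt 𝓘(ℝ, E) z).symm y)) x w)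
    (extChartAt 𝓘(ℝ, E) z z) v = _
  rw [fderiv_clm_apply h2 (differentiableAt_const _)]
  simp

omit [T2Space P] in
/-- The function adding to `F` a multiple of the squared increments of the `Q a` has a strict local
minimum at `z` if the Hessian of `F` is positive definite on the common kernel of the `dQ a`. -/
lemma exists_strict_local_min_of_hessian_pos {κ : Type*} [Fintype κ] {F : SmoothFun E P}
    {Q : κ → SmoothFun E P} {z : P} (hcrit : differential F z = 0)
    (hpos : ∀ v : TangentSpace 𝓘(ℝ, E) z, (∀ a, differential (Q a) z v = 0) → v ≠ 0 →
      0 < hessian F z v v) :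
    ∃ K : ℝ, ∀ᶠ x in 𝓝 z, x ≠ z → 0 < F x - F z + K * ∑ a, (Q a x - Q a z) ^ 2 := by
  set e := extChartAt 𝓘(ℝ, E) z
  have hsm : ∀ G : SmoothFun E P, ContDiffAt ℝ 2 (fun y => G (e.symm y)) (e z) := fun G =>
    ((G.contDiffOn_comp_extChartAt_symm z).contDiffAt (extChartAt_target_mem_nhds z)).of_le
      (by norm_cast)
  obtain ⟨K, hK⟩ := exists_strict_local_min_add_sum_sq (q := fun a y => Q a (e.symm y)) (hsm F)
    (fun a => (hsm (Q a)).differentiableAt two_ne_zero)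
    ((differential_eq_fderiv F z).symm.trans hcrit) (fun v hv hv0 => by
      rw [← hessian_eq_fderiv_fderiv]
      refine hpos v (fun a => ?_) hv0
      rw [differential_eq_fderiv]
      exact hv a)
  refine ⟨K, ?_⟩
  filter_upwards [(continuousAt_extChartAt (I := 𝓘(ℝ, E)) z).eventually hK,
    extChartAt_source_mem_nhds (I := 𝓘(ℝ, E)) z] with x hx hxs hne
  have h1 := hx fun h => hne (e.injOn hxs (mem_extChartAt_source z) h)
  have h2 : e.symm (extChartAt 𝓘(ℝ, E) z x) = x := e.left_inv hxs
  have h3 : e.symm (e z) = z := e.left_inv (mem_extChartAt_source z)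
  simpa only [h2, h3] using h1

end Stability

/-! ### Conservation of sub-Casimirs, passage to the reduced system, and the theorem -/

section IdealStability

open Set Filter

variable {E : Type*} [NormedAddCommGroup E] [NormedSpace ℝ E] [FiniteDimensional ℝ E]
  {P : Type*} [TopologicalSpace P] [T2Space P] [ChartedSpace E P] [IsManifold 𝓘(ℝ, E) ∞ P]
  {E' : Type*} [NormedAddCommGroup E'] [NormedSpace ℝ E']
  {S : Type*} [TopologicalSpace S] [ChartedSpace E' S] [IsManifold 𝓘(ℝ, E') ∞ S]
  {ι : C^∞⟮𝓘(ℝ, E'), S; 𝓘(ℝ, E), P⟯}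
  {π : PoissonStructure E P} {m : ℕ} {G : Fin m → SmoothFun E P}
  (hI : IsPoissonIdeal π (Ideal.span (range G))) (hreg : IsRegularVia (Ideal.span (range G)) ι)
include hI hreg

omit [IsManifold 𝓘(ℝ, E') ∞ S] in
-- The derivative along γ is {F, H}, which is zero on the vanishing set, and γ never leaves that
-- set. Away from it F need not be conserved.
lemma IsSubCasimir.eq_of_isMIntegralCurveOn {F : SmoothFun E P} (hF : IsSubCasimir π ι F)
    {H : SmoothFun E P} {γ : ℝ → P} {T : ℝ} (hγ : IsMIntegralCurveOn γ (π.hamVF H) (Icc 0 T))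
    (h0 : γ 0 ∈ vanishingSet (Ideal.span (range G))) {t : ℝ} (ht : t ∈ Icc 0 T) :
    F (γ t) = F (γ 0) := by
  have hzero : ∀ t ∈ Icc 0 T, π.bracket F H (γ t) = 0 := fun t ht => by
    have h1 := hI.mem_vanishingSet_of_isMIntegralCurveOn hγ h0 ht
    rw [← hreg.range_eq] at h1
    obtain ⟨s, hs⟩ := h1
    rw [← hs]
    exact hF.bracket_eq_zero hI hreg H s
  refine constant_of_has_deriv_right_zero (f := fun t => F (γ t))
    (fun t ht => (hγ.hasDerivWithinAt_smoothFun F ht).continuousWithinAt) (fun t ht => ?_) t ht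
  have h1 := hγ.hasDerivWithinAt_smoothFun F (Ico_subset_Icc_self ht)
  rw [hzero t (Ico_subset_Icc_self ht)] at h1
  exact h1.mono_of_mem_nhdsWithin (Icc_mem_nhdsGE_of_mem ht)

/-- Stability with respect to initial conditions in the vanishing set implies stability of the
reduced system. -/
lemma isStableEquilibrium_reduced {H : SmoothFun E P} {s_e : S} (h_eq : π.hamVF H (ι s_e) = 0)
    (hstab : ∀ U : Set P, IsOpen U → ι s_e ∈ U →
      ∃ V : Set P, IsOpen V ∧ ι s_e ∈ V ∧ ∀ z ∈ V ∩ vanishingSet (Ideal.span (range G)),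
        ForwardOrbitIn (π.hamVF H) z (U ∩ vanishingSet (Ideal.span (range G)))) :
    IsStableEquilibrium (hamiltonianVectorField (reducedBracket π ι) (H.comp ι)) s_e := by
  have hemb := hreg.isSmoothEmbedding.isEmbedding
  constructor
  · obtain ⟨ρ, N, hρ⟩ := hreg.isSmoothEmbedding.exists_isLocalRetraction s_e
    rw [← hρ.tangentMap_mfderiv (hamiltonianVectorField (reducedBracket π ι) (H.comp ι) s_e),
      mfderiv_reduced_hamiltonianVectorField hI hreg, h_eq, map_zero]
  · intro U hU hsU
    obtain ⟨U', hU', rfl⟩ := hemb.isInducing.isOpen_iff.1 hU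
    obtain ⟨V, hV, hsV, hstab⟩ := hstab U' hU' hsU
    refine ⟨ι ⁻¹' (V ∩ U'), (hV.inter hU').preimage hemb.continuous, ⟨hsV, hsU⟩,
      fun s hs => hs.2, fun s hs => ?_⟩
    obtain ⟨⟨γ, hγ0, hγ⟩, hall⟩ := hstab (ι s) ⟨hs.1, hreg.mem_vanishingSet s⟩
    constructor
    · have hmem : ∀ t : ℝ, 0 ≤ t → ∃ s', ι s' = γ t := fun t ht => by
        rw [← mem_range, hreg.range_eq]
        rcases ht.eq_or_lt with rfl | ht
        · rw [hγ0]
          exact hreg.mem_vanishingSet s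
        · exact (hall γ hγ0 hγ t ht).2
      -- Only nonnegative times are lifted; elsewhere the value is unconstrained.
      have hchoice : ∀ t : ℝ, ∃ s', 0 ≤ t → ι s' = γ t := fun t => by
        by_cases ht : 0 ≤ t
        · exact (hmem t ht).imp fun _ h _ => h
        · exact ⟨s, fun h => absurd h ht⟩
      choose σ hσ using hchoice
      refine ⟨σ, hemb.injective ?_, isMIntegralCurveOn_of_inclusion_comp hI hreg hγ hσ⟩
      rw [hσ 0 le_rfl, hγ0]
    · intro σ hσ0 hσ t ht
      exact (hall (ι ∘ σ) (congrArg ι hσ0) (isMIntegralCurveOn_inclusion_comp hI hreg hσ) t ht).1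

end IdealStability

theorem theorem2p10
    -- the Poisson dynamical system `(P, {·,·}, H)`
    {E : Type*} [NormedAddCommGroup E] [NormedSpace ℝ E] [FiniteDimensional ℝ E]
    {P : Type*} [TopologicalSpace P] [T2Space P] [ChartedSpace E P] [IsManifold 𝓘(ℝ, E) ∞ P]
    (π : PoissonStructure E P) (H : SmoothFun E P)
    -- the equilibrium
    (z_e : P) (h_eq : π.hamVF H z_e = 0)
    -- the regular Poisson ideal generated by `G_1, …, G_m`, with vanishing submanifold `S`
    {m : ℕ} (G : Fin m → SmoothFun E P)
    (I : Ideal (SmoothFun E P)) (hI_gen : I = Ideal.span (Set.range G))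
    (hI_poisson : IsPoissonIdeal π I)
    {E' : Type*} [NormedAddCommGroup E'] [NormedSpace ℝ E'] [FiniteDimensional ℝ E']
    {S : Type*} [TopologicalSpace S] [ChartedSpace E' S] [IsManifold 𝓘(ℝ, E') ∞ S]
    (ι : C^∞⟮𝓘(ℝ, E'), S; 𝓘(ℝ, E), P⟯) (hI_regular : IsRegularVia I ι)
    (hz_mem : z_e ∈ vanishingSet I)
    -- the sub-Casimirs `F_1, …, F_r`
    {r : ℕ} (F : Fin r → SmoothFun E P) (hF : ∀ j, IsSubCasimir π ι (F j))
    -- the conserved quantities `C_0 = H, C_1, …, C_n`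
    {n : ℕ} (C : Fin (n + 1) → SmoothFun E P) (hC_zero : C 0 = H)
    (hC : ∀ i, IsConservedBy (π.hamVF H) (C i))
    -- the constants and the function `H_1`
    (lam : Fin (n + 1) → ℝ) (mu : Fin r → ℝ) (nu : Fin m → ℝ)
    (H₁ : SmoothFun E P)
    (hH₁ : H₁ = ∑ i, lam i • C i + ∑ j, mu j • F j + ∑ k, nu k • G k)
    (h_crit : differential H₁ z_e = 0)
    (h_pos : ∀ v : TangentSpace 𝓘(ℝ, E) z_e,
      (∀ i, differential (C i) z_e v = 0) → (∀ j, differential (F j) z_e v = 0) →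
      (∀ k, differential (G k) z_e v = 0) → v ≠ 0 → 0 < hessian H₁ z_e v v) :
    IsIdealStable π H I ι z_e := by
  subst hI_gen
  -- `W` is the common kernel of the differentials of this combined family.
  obtain ⟨K, hK⟩ := exists_strict_local_min_of_hessian_pos (Q := Sum.elim C (Sum.elim F G)) h_crit
    fun v hv => h_pos v (fun i => hv (.inl i)) (fun j => hv (.inr (.inl j)))
      fun k => hv (.inr (.inr k))
  have hstab : ∀ U : Set P, IsOpen U → z_e ∈ U →
      ∃ V : Set P, IsOpen V ∧ z_e ∈ V ∧ ∀ z ∈ V ∩ vanishingSet (Ideal.span (Set.range G)),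
        ForwardOrbitIn (π.hamVF H) z (U ∩ vanishingSet (Ideal.span (Set.range G))) := by
    intro U hU hzU
    refine π.exists_nhds_forwardOrbitIn H (Φ := fun z => H₁ z - H₁ z_e + K *
      ∑ a, (Sum.elim C (Sum.elim F G) a z - Sum.elim C (Sum.elim F G) a z_e) ^ 2) (Continuous.add (H₁.contMDiff.continuous.sub
      continuous_const) (continuous_const.mul (continuous_finsetSum _ fun a _ =>
        ((SmoothFun.contMDiff _).continuous.sub continuous_const).pow 2))) (by simp) hK ?_ hU hzU
    intro γ T hγ h0 t ht
    have hV := hI_poisson.mem_vanishingSet_of_isMIntegralCurveOn hγ h0 ht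
    have hCt : ∀ i, C i (γ t) = C i (γ 0) := fun i =>
      hC i γ _ Set.ordConnected_Icc hγ t ht 0 (Set.left_mem_Icc.2 (ht.1.trans ht.2))
    have hFt : ∀ j, F j (γ t) = F j (γ 0) := fun j =>
      (hF j).eq_of_isMIntegralCurveOn hI_poisson hI_regular hγ h0 ht
    have hGt : ∀ k, G k (γ t) = G k (γ 0) := fun k => by
      rw [mem_vanishingSet_span_range.1 hV, mem_vanishingSet_span_range.1 h0]
    have hQt : ∀ a, Sum.elim C (Sum.elim F G) a (γ t) = Sum.elim C (Sum.elim F G) a (γ 0) := by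
      rintro (i | j | k)
      exacts [hCt i, hFt j, hGt k]
    -- `H₁` is a linear combination of functions already shown constant along `γ`.
    have hH₁t : H₁ (γ t) = H₁ (γ 0) := by
      have hev : ∀ z, H₁ z = ∑ i, lam i * C i z + ∑ j, mu j * F j z + ∑ k, nu k * G k z := by
        intro z
        simp only [hH₁, ContMDiffMap.coe_add, Pi.add_apply, ContMDiffMap.finsetSum_apply,
          ContMDiffMap.coe_smul, Pi.smul_apply, smul_eq_mul]
      simp only [hev, hCt, hFt, hGt]
    refine ⟨hV, ?_⟩
    simp only [hH₁t, hQt]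
  refine ⟨hz_mem, h_eq, ?_, hstab⟩
  rintro s_e rfl
  exact isStableEquilibrium_reduced hI_poisson hI_regular h_eq hstab
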